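/- **Setting.** Let $(R,\mathfrak m,\Bbbk)$ be a Noetherian local domain of dimension $d\ge 1$ with fraction field $\mathbb F$. For $\mathbf a\in\mathbb R^d$ with $\mathbb Q$-linearly independent components, order $\mathbb Z^d$ by $u\le v\iff\langle u,\mathbf a\rangle\le\langle v,\mathbf a\rangle$. A valuation $\nu:\mathbb F^\times\to\mathbb Z^d$, with valuation ring $(V_\nu,\mathfrak m_\nu,\Bbbk_\nu)$, is *OK relative to $R$* if: (1) $\nu(\mathbb F^\times)=\mathbb Z^d$ is generated as a group by $\nu(R\setminus 0)$; (2) $R\subset V_\nu$ and $\mathfrak m\subset\mathfrak m_\nu$; (3) for some $0<c<\|\mathbf a\|$, the closed convex cone generated by $\nu(R\setminus 0)$ lies in $\{\mathbf x:\langle \mathbf x,\mathbf a\rangle\ge c\|\mathbf x\|\}$; (4) $[\Bbbk_\nu:\Bbbk]<\infty$; (5) there is $\mathbf v\in\mathbb Z^d$ such that, for all $n\in\mathbb N$, every $r \in R$ with $r=0$ or $\nu(r)\ge n\mathbf v$ lies in $\mathfrak m^n$. $R$ is an *OK domain* if such $\mathbf a$ and $\nu$ exist. For an ideal $I$ write $I^{[q]}=(a^q: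 a\in I)$. A family of ideals $I_\bullet=\{I_n\}_{n\in\mathbb N}$ is *weakly graded* if there is $0\ne c\in R$ with $cI_mI_n\subset I_{m+n}$ for all $m,n$; *BBL* (bounded below linearly) if there is $c\in\mathbb N$ with $\mathfrak m^{cn}\subset I_n$ for all $n$; *BAL* (bounded above linearly) if there is an integer $c\ge1$ with $I_n\subset\mathfrak m^{\lfloor n/c\rfloor}$ for all $n$. If $R$ has prime characteristic $p$, a family $I_\bullet=\{I_q\}$ indexed by the powers $q=p^e$ ($e \geq 0$) is a *weakly $p$-family* (resp. *weakly inverse $p$-family*) if there is $0\ne c\in R$ with $cI_q^{[p]}\subset I_{pq}$ (resp. $cI_{pq}\subset I_q^{[p]}$) for all $q$; *BBL* if there is $c\in\mathbb N$ with $\mathfrak m^{cq}\subset I_q$ for all $q$; *BAL* if there is a power $q_0$ of $p$ with $I_{qq_0}\subset\mathfrak m^{[q]}$ for all $q$. **Theorem B.** Let $R$ be an OK domain of dimension $d$. (a) If $I_\bullet$ is a BBL weakly graded family of ideals, then $\lim_{n\to\infty}\ell(R/I_n)/n^d$ exists in $\mathbb R$, and it is positive if and only if $I_\bullet$ is BAL.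 (b) Suppose $R$ has characteristic $p>0$, and $I_\bullet$ is either a BBL weakly $p$-family, or a BBL weakly inverse $p$-family while $R$ is $F$-finite with perfect residue field. Then $\lim_{q\to\infty}\ell(R/I_q)/q^d$ exists in $\mathbb R$, and it is positive if and only if $I_\bullet$ is BAL. -/

import Mathlib

open Filter Topology

noncomputable section

namespace OKVal

/-! ### The lattice `ℤ^d` ordered by a weight vector -/

/-- A vector `a ∈ ℝ^d` whose components are linearly independent over `ℚ`. -/
structure Weight (d : ℕ) where
  /-- the vector itself -/
  vec : EuclideanSpace ℝ (Fin d)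
  /-- its components are linearly independent over the rationals -/
  linearIndependent : LinearIndependent ℚ (fun i => vec i)

/-- The lattice `ℤ^d`, to be ordered by `u ≤ v ↔ ⟨u, a⟩ ≤ ⟨v, a⟩`. -/
def WLattice {d : ℕ} (_a : Weight d) : Type := Fin d → ℤ

instance {d : ℕ} (a : Weight d) : AddCommGroup (WLattice a) :=
  inferInstanceAs (AddCommGroup (Fin d → ℤ))

/-- The inclusion `ℤ^d ⊆ ℝ^d`. -/
def latticeToEuclidean {d : ℕ} {a : Weight d} (u : WLattice a) : EuclideanSpace ℝ (Fin d) :=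
  WithLp.toLp 2 (fun i => ((u : Fin d → ℤ) i : ℝ))

/-- The embedding `⟨·, a⟩ : ℤ^d → ℝ`. -/
def pairing {d : ℕ} (a : Weight d) : WLattice a →+ ℝ where
  toFun u := ∑ i, ((u : Fin d → ℤ) i : ℝ) * a.vec i
  map_zero' := Finset.sum_eq_zero fun i _ => by
    change (((0 : Fin d → ℤ) i : ℤ) : ℝ) * a.vec i = 0
    simp
  map_add' u v := by
    rw [← Finset.sum_add_distrib]
    refine Finset.sum_congr rfl fun i _ => ?_
    rw [← add_mul, ← Int.cast_add]
    rfl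

theorem pairing_injective {d : ℕ} (a : Weight d) : Function.Injective (pairing a) := by
  rw [injective_iff_map_eq_zero]
  intro u hu
  have h := Fintype.linearIndependent_iff.1 a.linearIndependent
    (fun i => (((u : Fin d → ℤ) i : ℤ) : ℚ)) (by
      rw [← hu]
      refine Finset.sum_congr rfl fun i _ => ?_
      rw [Rat.smul_def]
      push_cast
      rfl)
  funext i
  exact_mod_cast h i

instance {d : ℕ} (a : Weight d) : LinearOrder (WLattice a) :=
  LinearOrder.lift' (pairing a) (pairing_injective a)

theorem le_iff {d : ℕ} {a : Weight d} {u v : WLattice a} :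
    u ≤ v ↔ pairing a u ≤ pairing a v := Iff.rfl

instance {d : ℕ} (a : Weight d) : IsOrderedAddMonoid (WLattice a) where
  add_le_add_left u v h w := by
    rw [le_iff, map_add, map_add]
    have := le_iff.1 h
    linarith

/-! ### OK valuations and OK domains -/

/-- `Cone(U)`: the smallest closed convex cone (with vertex `0`) containing `U`, i.e. the closure
of the set of all nonnegative linear combinations of elements of `U`. -/
def closedCone {d : ℕ} (U : Set (EuclideanSpace ℝ (Fin d))) : Set (EuclideanSpace ℝ (Fin d)) :=
  closure (PointedCone.hull ℝ U : Set (EuclideanSpace ℝ (Fin d)))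

/-- `C` is pointed at the direction of `a`: it lies in a circular cone
`{x | ⟨x, a⟩ ≥ c ‖x‖}` with `0 < c < ‖a‖`. -/
def IsPointedAt {d : ℕ} (C : Set (EuclideanSpace ℝ (Fin d))) (a : EuclideanSpace ℝ (Fin d)) :
    Prop :=
  ∃ c : ℝ, 0 < c ∧ c < ‖a‖ ∧ ∀ x ∈ C, c * ‖x‖ ≤ inner ℝ x a

variable (R : Type*) [CommRing R] [IsDomain R]

/-- A `ℤ^d`-valued valuation on the fraction field of `R`, where `ℤ^d` is ordered by `a`; the
value of `0` is `⊤`. -/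
abbrev FracValuation {d : ℕ} (a : Weight d) : Type _ :=
  AddValuation (FractionRing R) (WithTop (WLattice a))

variable {R}

/-- The valuation ring `V_ν = {x | ν x ≥ 0}` of `ν`. -/
abbrev valRing {d : ℕ} {a : Weight d} (ν : FracValuation R a) : ValuationSubring (FractionRing R) :=
  (AddValuation.toValuation ν).valuationSubring

theorem mem_valRing {d : ℕ} {a : Weight d} (ν : FracValuation R a) (x : FractionRing R) :
    x ∈ valRing ν ↔ 0 ≤ ν x := Iff.rfl

/-- The value semigroup `ν(R) = {ν x | 0 ≠ x ∈ R}`. -/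
def valueSemigroup {d : ℕ} {a : Weight d} (ν : FracValuation R a) : Set (WLattice a) :=
  {u | ∃ r : R, r ≠ 0 ∧ ν (algebraMap R (FractionRing R) r) = (u : WithTop (WLattice a))}

variable [IsLocalRing R]

/-- `R` is dominated by `ν`: `R ⊆ V_ν` and `𝔪 ⊆ 𝔪_ν`. -/
structure Dominates {d : ℕ} {a : Weight d} (ν : FracValuation R a) : Prop where
  nonneg : ∀ r : R, 0 ≤ ν (algebraMap R (FractionRing R) r)
  pos : ∀ r ∈ IsLocalRing.maximalIdeal R, 0 < ν (algebraMap R (FractionRing R) r)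

/-- The inclusion `R → V_ν`. -/
def Dominates.inclusion {d : ℕ} {a : Weight d} {ν : FracValuation R a} (h : Dominates ν) :
    R →+* valRing ν :=
  (algebraMap R (FractionRing R)).codRestrict (valRing ν).toSubring
    fun r => (mem_valRing ν _).2 (h.nonneg r)

theorem Dominates.isLocalHom {d : ℕ} {a : Weight d} {ν : FracValuation R a} (h : Dominates ν) :
    IsLocalHom h.inclusion where
  map_nonunit r hr := by
    by_contra hr'
    have hpos := h.pos r ((IsLocalRing.mem_maximalIdeal r).2 hr')
    obtain ⟨y, hy⟩ := hr.exists_right_inv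
    have hy' : algebraMap R (FractionRing R) r * (y : FractionRing R) = 1 :=
      congrArg (Subtype.val) hy
    have h0 : ν (algebraMap R (FractionRing R) r) + ν (y : FractionRing R) = 0 := by
      rw [← AddValuation.map_mul, hy', AddValuation.map_one]
    have hy0 : 0 ≤ ν (y : FractionRing R) := (mem_valRing ν _).1 y.2
    exact absurd h0 (add_pos_of_pos_of_nonneg hpos hy0).ne'

/-- The extension of residue fields `𝕜 = R/𝔪 → 𝕜_ν = V_ν/𝔪_ν`. -/
def Dominates.residueMap {d : ℕ} {a : Weight d} {ν : FracValuation R a} (h : Dominates ν) :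
    IsLocalRing.ResidueField R →+* IsLocalRing.ResidueField (valRing ν) :=
  haveI := h.isLocalHom
  IsLocalRing.ResidueField.map h.inclusion

/-- `ν` is an OK valuation relative to `R`. -/
structure IsOK {d : ℕ} {a : Weight d} (ν : FracValuation R a) : Prop where
  /-- the rank of the lattice is the dimension of `R` -/
  dim_eq : ringKrullDim R = d
  /-- the value group of `ν` is `ℤ^d` -/
  surjective : ∀ u : WLattice a, ∃ x : FractionRing R, ν x = (u : WithTop (WLattice a))
  /-- the value semigroup of `R` generates `ℤ^d` as a group -/
  closure_eq : AddSubgroup.closure (valueSemigroup ν) = ⊤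
  /-- `R` is dominated by `ν` -/
  dominates : Dominates ν
  /-- the cone of the value semigroup is pointed at the direction of `a` -/
  pointed : IsPointedAt (closedCone (latticeToEuclidean '' valueSemigroup ν)) a.vec
  /-- `[𝕜_ν : 𝕜] < ∞` -/
  residue_finite : dominates.residueMap.Finite
  /-- there is `v ∈ ℤ^d` with `{r ∈ R | ν r ≥ n v} ⊆ 𝔪 ^ n` for all `n` -/
  exists_le_pow : ∃ v : WLattice a, ∀ (n : ℕ) (r : R),
    ((n • v : WLattice a) : WithTop (WLattice a)) ≤ ν (algebraMap R (FractionRing R) r) →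
      r ∈ IsLocalRing.maximalIdeal R ^ n

variable (R)

/-- A (Noetherian) local domain `R` is an OK domain if its fraction field has a valuation which is
OK relative to `R`. -/
def IsOKDomain : Prop :=
  ∃ (d : ℕ) (a : Weight d) (ν : FracValuation R a), IsOK ν

end OKVal

namespace IdealFamily

variable {R : Type*} [CommRing R]

/-- `R° = R \ ⋃ P`, the union over all primes `P` with `dim R/P = dim R`. -/
def circ (R : Type*) [CommRing R] : Set R :=
  {x | ∀ P : Ideal R, P.IsPrime → ringKrullDim (R ⧸ P) = ringKrullDim R → x ∉ P}

/-- The Frobenius power `I^{[q]}`, generated by the `q`-th powers of the elements of `I`. -/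
def frobeniusPow (I : Ideal R) (q : ℕ) : Ideal R :=
  Ideal.span ((fun x => x ^ q) '' (I : Set R))

/-- The colength `ℓ(R/I)` as a real number (for `I` with `R/I` of finite length). -/
def colength (I : Ideal R) : ℝ := ((Module.length R (R ⧸ I)).toNat : ℝ)

/-! Families indexed by `ℕ`. -/

/-- Weakly graded families: `c I_m I_n ⊆ I_{m+n}` for some `c ∈ R°` and all `m, n`. -/
def IsWeaklyGraded (I : ℕ → Ideal R) : Prop :=
  ∃ c ∈ circ R, ∀ m n : ℕ, Ideal.span {c} * (I m * I n) ≤ I (m + n)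

/-- Bounded below linearly: `𝔪^{cn} ⊆ I_n` for some `c` and all `n`. -/
def IsBBL [IsLocalRing R] (I : ℕ → Ideal R) : Prop :=
  ∃ c : ℕ, ∀ n : ℕ, IsLocalRing.maximalIdeal R ^ (c * n) ≤ I n

/-- Bounded above linearly: `I_n ⊆ 𝔪^{⌊n/c⌋}` for some `c ≥ 1` and all `n`. -/
def IsBAL [IsLocalRing R] (I : ℕ → Ideal R) : Prop :=
  ∃ c : ℕ, 0 < c ∧ ∀ n : ℕ, I n ≤ IsLocalRing.maximalIdeal R ^ (n / c)

/-! Families indexed by the powers of `p`: here `I e` stands for `I_q` with `q = p ^ e`. -/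

/-- Weakly `p`-families: `c I_q^{[p]} ⊆ I_{pq}` for some `c ∈ R°` and all `q`. -/
def IsWeaklyPFamily (p : ℕ) (I : ℕ → Ideal R) : Prop :=
  ∃ c ∈ circ R, ∀ e : ℕ, Ideal.span {c} * frobeniusPow (I e) p ≤ I (e + 1)

/-- Weakly inverse `p`-families: `c I_{pq} ⊆ I_q^{[p]}` for some `c ∈ R°` and all `q`. -/
def IsWeaklyInversePFamily (p : ℕ) (I : ℕ → Ideal R) : Prop :=
  ∃ c ∈ circ R, ∀ e : ℕ, Ideal.span {c} * I (e + 1) ≤ frobeniusPow (I e) p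

/-- Bounded below linearly: `𝔪^{cq} ⊆ I_q` for some `c` and all `q`. -/
def IsBBLPow [IsLocalRing R] (p : ℕ) (I : ℕ → Ideal R) : Prop :=
  ∃ c : ℕ, ∀ e : ℕ, IsLocalRing.maximalIdeal R ^ (c * p ^ e) ≤ I e

/-- Bounded above linearly: `I_{q q₀} ⊆ 𝔪^{[q]}` for some power `q₀ = p ^ e₀` of `p` and all
`q = p ^ e`. -/
def IsBALPow [IsLocalRing R] (p : ℕ) (I : ℕ → Ideal R) : Prop :=
  ∃ e₀ : ℕ, ∀ e : ℕ, I (e + e₀) ≤ frobeniusPow (IsLocalRing.maximalIdeal R) (p ^ e)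

end IdealFamily

end

/-! Write `d + 1` for the dimension. The valuation turns colengths into lattice point counts. Filter
an ideal `M` by value: each graded piece is a subspace of the residue field of `ν`, nonzero exactly
at the values of `M`, and it is the whole residue field at `u + β` for every value `u` of `M`, with
one fixed `β`. Hence, if `M` contains every element of weight at least `t`, its colength is the
residue degree times the number of values below `t` missed by `M`, up to `O(t ^ d)`
(`IsOK.exists_colength_estimate`). A BBL family admits such a `t` linear in the index.

No convex bodies are needed for the limits. The value semigroup contains translates of cubes of side
`n`, at linear cost, so a set of values containing `n • T + z` has at least `n ^ (d + 1)` times as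
many elements as `T`, after a bounded relative enlargement of the cut-off. A thin slab contains few
semigroup elements, so this enlargement is asymptotically harmless. The normalized counts are thus
almost superadditive and converge (`IsPointedSemigroup.exists_tendsto_cnt`). This covers weakly
graded families and weakly `p`-families.

For weakly inverse `p`-families, `R` contains `p ^ (d + 1)` elements independent over its `p`-th
powers, having values in distinct classes modulo `p`. This bounds `p ^ (d + 1) * ℓ(R/I)` by
`ℓ(R/I^{[p]})` up to lower order, so the normalized colengths increase up to a summable error.

For positivity, elements of weight at least `t` form an ideal of colength of order `t ^ (d + 1)`,
and these ideals are linearly comparable with the powers of `𝔪`. BAL therefore forces a positive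
limit. If BAL fails, some `I_j` contain nonzero elements of weight `o(s_j)`, where `s_j` is the
scale, and quotients by such elements have colength `o(s_j ^ (d + 1))`
(`IsOK.exists_colength_sup_le`). -/

noncomputable section

namespace OKVal

/-! ### Pointed semigroups in the lattice and the cubes they contain. -/

section Counting

variable {d : ℕ} {a : Weight d}

/-- The standard basis vectors of `ℤ^d`. -/
def stdVec (a : Weight d) (i : Fin d) : WLattice a := (Pi.single i 1 : Fin d → ℤ)

/-- The natural vector `k` as an element of the lattice. -/
def natVec (a : Weight d) (k : Fin d → ℕ) : WLattice a := (fun i => (k i : ℤ) : Fin d → ℤ)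

theorem coe_nsmul (n : ℕ) (u : WLattice a) (i : Fin d) :
    ((n • u : WLattice a) : Fin d → ℤ) i = n * (u : Fin d → ℤ) i := by
  have h : ∀ v : Fin d → ℤ, (n • v) i = n * v i := fun v => by simp
  exact h u

theorem coe_add (u v : WLattice a) (i : Fin d) :
    ((u + v : WLattice a) : Fin d → ℤ) i = (u : Fin d → ℤ) i + (v : Fin d → ℤ) i := rfl

theorem natVec_eq_sum (k : Fin d → ℕ) : natVec a k = ∑ i, k i • stdVec a i := by
  change (fun i => (k i : ℤ) : Fin d → ℤ) = ∑ i, k i • (Pi.single i 1 : Fin d → ℤ)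
  funext j
  simp [Finset.sum_apply, Pi.single_apply]

theorem pairing_natVec (k : Fin d → ℕ) : pairing a (natVec a k) = ∑ i, (k i : ℝ) * a.vec i := by
  change ∑ i, (((k i : ℤ)) : ℝ) * a.vec i = _
  simp

theorem pairing_eq_inner (u : WLattice a) :
    pairing a u = inner ℝ (latticeToEuclidean u) a.vec := by
  rw [PiLp.inner_apply]
  change ∑ i, (((u : Fin d → ℤ) i : ℤ) : ℝ) * a.vec i = _
  refine Finset.sum_congr rfl fun i _ => ?_
  simp [latticeToEuclidean, mul_comm]

theorem Weight.vec_ne_zero (a : Weight d) (i : Fin d) : a.vec i ≠ 0 :=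
  a.linearIndependent.ne_zero i

/-- A subsemigroup of `ℤ^d` that contains `0`, generates `ℤ^d` as a group and lies in a circular
cone around `a`. -/
structure IsPointedSemigroup (S : Set (WLattice a)) : Prop where
  zero_mem : 0 ∈ S
  add_mem : ∀ u ∈ S, ∀ v ∈ S, u + v ∈ S
  closure_eq : AddSubgroup.closure S = ⊤
  cone : ∃ c : ℝ, 0 < c ∧ ∀ u ∈ S, c * ‖latticeToEuclidean u‖ ≤ pairing a u

/-- The number of elements of `T` whose pairing with `a` is less than `x`. -/
def cnt (T : Set (WLattice a)) (x : ℝ) : ℕ := {u ∈ T | pairing a u < x}.ncard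

namespace IsPointedSemigroup

variable {S : Set (WLattice a)} (hS : IsPointedSemigroup S)

include hS

theorem pairing_nonneg {u : WLattice a} (hu : u ∈ S) : 0 ≤ pairing a u := by
  obtain ⟨c, hc, h⟩ := hS.cone
  exact le_trans (by positivity) (h u hu)

theorem nsmul_mem (n : ℕ) {u : WLattice a} (hu : u ∈ S) : n • u ∈ S := by
  induction n with
  | zero => simpa using hS.zero_mem
  | succ n ih => rw [succ_nsmul]; exact hS.add_mem _ ih _ hu

theorem sum_mem {ι : Type*} (s : Finset ι) (f : ι → WLattice a) (h : ∀ i ∈ s, f i ∈ S) :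
    ∑ i ∈ s, f i ∈ S := by
  classical
  induction s using Finset.induction_on with
  | empty => simpa using hS.zero_mem
  | insert i s hi ih =>
    rw [Finset.sum_insert hi]
    exact hS.add_mem _ (h i (by simp)) _ (ih fun j hj => h j (by simp [hj]))

theorem exists_coord_le : ∃ c : ℝ, 0 < c ∧ ∀ u ∈ S, ∀ i : Fin d,
    |(((u : Fin d → ℤ) i : ℤ) : ℝ)| ≤ pairing a u / c := by
  obtain ⟨c, hc, h⟩ := hS.cone
  refine ⟨c, hc, fun u hu i => ?_⟩
  rw [le_div_iff₀ hc, mul_comm]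
  refine le_trans (mul_le_mul_of_nonneg_left ?_ hc.le) (h u hu)
  have := PiLp.norm_apply_le (latticeToEuclidean u) i
  simpa [latticeToEuclidean] using this

theorem finite_lt (x : ℝ) : {u ∈ S | pairing a u < x}.Finite := by
  obtain ⟨c, hc, h⟩ := hS.exists_coord_le
  have hfin : (Set.univ.pi fun _ : Fin d => Set.Icc (-⌈x / c⌉) ⌈x / c⌉).Finite :=
    Set.Finite.pi fun _ => Set.finite_Icc _ _
  refine Set.Finite.subset (s := (Set.univ.pi fun _ : Fin d => Set.Icc (-⌈x / c⌉) ⌈x / c⌉ :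
    Set (Fin d → ℤ))) hfin ?_
  rintro u ⟨hu, hux⟩ i -
  have h1 : |(((u : Fin d → ℤ) i : ℤ) : ℝ)| ≤ (⌈x / c⌉ : ℝ) :=
    (h u hu i).trans ((div_le_div_of_nonneg_right hux.le hc.le).trans (Int.le_ceil _))
  have h2 : |(u : Fin d → ℤ) i| ≤ ⌈x / c⌉ := by exact_mod_cast h1
  exact abs_le.1 h2

theorem finite_lt_of_subset {T : Set (WLattice a)} (hT : T ⊆ S) (x : ℝ) :
    {u ∈ T | pairing a u < x}.Finite :=
  (hS.finite_lt x).subset fun _ hu => ⟨hT hu.1, hu.2⟩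

theorem cnt_mono {T T' : Set (WLattice a)} (hT : T ⊆ T') (hT' : T' ⊆ S) {x y : ℝ} (h : x ≤ y) :
    cnt T x ≤ cnt T' y :=
  Set.ncard_le_ncard (fun _ hu => ⟨hT hu.1, hu.2.trans_le h⟩) (hS.finite_lt_of_subset hT' y)

theorem exists_sub_eq (u : WLattice a) : ∃ s ∈ S, ∃ t ∈ S, u + t = s := by
  have hu : u ∈ AddSubgroup.closure S := by rw [hS.closure_eq]; trivial
  induction hu using AddSubgroup.closure_induction with
  | mem x hx => exact ⟨x, hx, 0, hS.zero_mem, add_zero x⟩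
  | zero => exact ⟨0, hS.zero_mem, 0, hS.zero_mem, add_zero 0⟩
  | add x y _ _ hx hy =>
    obtain ⟨s, hs, t, ht, rfl⟩ := hx
    obtain ⟨s', hs', t', ht', rfl⟩ := hy
    exact ⟨_, hS.add_mem _ hs _ hs', _, hS.add_mem _ ht _ ht', by abel⟩
  | neg x _ hx =>
    obtain ⟨s, hs, t, ht, rfl⟩ := hx
    exact ⟨t, ht, _, hs, by abel⟩

/-- The semigroup contains translates of arbitrarily large cubes, the translation growing linearly
with the size of the cube. -/
theorem exists_cube : ∃ w : WLattice a, w ∈ S ∧ ∀ (n : ℕ) (k : Fin d → ℕ), (∀ i, k i ≤ n) →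
    n • w + natVec a k ∈ S := by
  choose s hs t ht hst using fun i => hS.exists_sub_eq (stdVec a i)
  refine ⟨∑ i, t i, hS.sum_mem _ _ fun i _ => ht i, fun n k hk => ?_⟩
  rw [natVec_eq_sum, Finset.smul_sum, ← Finset.sum_add_distrib]
  refine hS.sum_mem _ _ fun i _ => ?_
  obtain ⟨m, hm⟩ := Nat.exists_eq_add_of_le (hk i)
  -- Since the basis vector is `s i - t i`, trading `k i ≤ n` of the `n` copies of `t i` for copies
  -- of `s i` stays inside the semigroup.
  have : n • t i + k i • stdVec a i = m • t i + k i • s i := by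
    rw [hm, ← hst, add_smul, smul_add]; abel
  rw [this]
  exact hS.add_mem _ (hS.nsmul_mem _ (ht i)) _ (hS.nsmul_mem _ (hs i))

end IsPointedSemigroup

theorem card_le_of_abs_sub_le (F : Finset ℤ) (D : ℝ) (hD : 0 ≤ D)
    (h : ∀ x ∈ F, ∀ y ∈ F, ((x - y : ℤ) : ℝ) ≤ D) : F.card ≤ ⌊D⌋₊ + 1 := by
  rcases F.eq_empty_or_nonempty with rfl | hF
  · simp
  have hsub : F ⊆ Finset.Icc (F.min' hF) (F.min' hF + ⌊D⌋₊) := by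
    intro x hx
    rw [Finset.mem_Icc]
    refine ⟨F.min'_le x hx, ?_⟩
    have h1 := h x hx _ (F.min'_mem hF)
    have h2 : x - F.min' hF ≤ ⌊D⌋ := Int.le_floor.2 h1
    rw [← Int.natCast_floor_eq_floor hD] at h2
    omega
  refine (Finset.card_le_card hsub).trans ?_
  rw [Int.card_Icc]
  omega

end Counting

/-! ### Upper and lower bounds for lattice point counts. -/

section Slab

variable {d : ℕ} {a : Weight (d + 1)} {S : Set (WLattice a)}

/-- The cone condition confines the last `d` coordinates to a box of side `O(1 + t)`. Once they are
fixed, the slab leaves the first coordinate an interval of length `(t - s) / |a 0|`, where `a 0 ≠ 0`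
by rational independence. -/
theorem IsPointedSemigroup.ncard_slab_le (hS : IsPointedSemigroup S) :
    ∃ K : ℝ, 0 ≤ K ∧ ∀ s t : ℝ, s ≤ t → 0 ≤ t →
      ({u ∈ S | s ≤ pairing a u ∧ pairing a u < t}.ncard : ℝ) ≤
        K * (1 + (t - s)) * (1 + t) ^ d := by
  obtain ⟨c, hc, hcoord⟩ := hS.exists_coord_le
  have ha : 0 < |a.vec 0| := abs_pos.2 (a.vec_ne_zero 0)
  refine ⟨(1 / |a.vec 0| + 1) * (2 / c + 1) ^ d, by positivity, fun s t hst ht => ?_⟩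
  have hfin : {u ∈ S | s ≤ pairing a u ∧ pairing a u < t}.Finite :=
    (hS.finite_lt t).subset fun u hu => ⟨hu.1, hu.2.2⟩
  set F := hfin.toFinset with hF
  have hmem : ∀ u, u ∈ F ↔ u ∈ S ∧ s ≤ pairing a u ∧ pairing a u < t := fun u => by
    rw [hF, Set.Finite.mem_toFinset]; rfl
  rw [Set.ncard_eq_toFinset_card _ hfin]
  let f : WLattice a → (Fin d → ℤ) := fun u j => (u : Fin (d + 1) → ℤ) j.succ
  set B := ⌊t / c⌋ with hB
  set D := (t - s) / |a.vec 0| with hD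
  have hD0 : 0 ≤ D := div_nonneg (by linarith) ha.le
  have hfiber : ∀ b ∈ F.image f, (F.filter (fun u => f u = b)).card ≤ ⌊D⌋₊ + 1 := by
    intro b _
    have hinj : Set.InjOn (fun u : WLattice a => (u : Fin (d + 1) → ℤ) 0)
        (F.filter (fun u => f u = b)) := by
      intro u hu v hv huv
      have hu' := (Finset.mem_filter.1 hu).2
      have hv' := (Finset.mem_filter.1 hv).2
      funext j
      refine Fin.cases huv (fun j => ?_) j
      exact congrFun (hu'.trans hv'.symm) j
    rw [← Finset.card_image_of_injOn hinj]
    refine card_le_of_abs_sub_le _ D hD0 ?_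
    intro x hx y hy
    obtain ⟨u, hu, rfl⟩ := Finset.mem_image.1 hx
    obtain ⟨v, hv, rfl⟩ := Finset.mem_image.1 hy
    obtain ⟨hu1, hu2⟩ := Finset.mem_filter.1 hu
    obtain ⟨hv1, hv2⟩ := Finset.mem_filter.1 hv
    have hu3 := (hmem u).1 hu1
    have hv3 := (hmem v).1 hv1
    have hdiff : pairing a u - pairing a v =
        (((u : Fin (d + 1) → ℤ) 0 - (v : Fin (d + 1) → ℤ) 0 : ℤ) : ℝ) * a.vec 0 := by
      change ∑ i, (((u : Fin (d + 1) → ℤ) i : ℤ) : ℝ) * a.vec i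
        - ∑ i, (((v : Fin (d + 1) → ℤ) i : ℤ) : ℝ) * a.vec i = _
      rw [Fin.sum_univ_succ, Fin.sum_univ_succ]
      have : ∀ j : Fin d, (u : Fin (d + 1) → ℤ) j.succ = (v : Fin (d + 1) → ℤ) j.succ :=
        fun j => congrFun (hu2.trans hv2.symm) j
      simp only [this]
      push_cast
      ring
    rw [hD, le_div_iff₀ ha]
    refine (mul_le_mul_of_nonneg_right (le_abs_self _) ha.le).trans ?_
    rw [← abs_mul, ← hdiff, abs_le]
    constructor <;> linarith
  have himage : (F.image f).card ≤ (2 * ⌊t / c⌋₊ + 1) ^ d := by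
    have hsub : F.image f ⊆ Fintype.piFinset fun _ : Fin d =>
        Finset.Icc (-(⌊t / c⌋₊ : ℤ)) ⌊t / c⌋₊ := by
      intro x hx
      obtain ⟨u, hu, rfl⟩ := Finset.mem_image.1 hx
      rw [Fintype.mem_piFinset]
      intro j
      have hu3 := (hmem u).1 hu
      have h1 : |(((u : Fin (d + 1) → ℤ) j.succ : ℤ) : ℝ)| ≤ t / c :=
        (hcoord u hu3.1 j.succ).trans (div_le_div_of_nonneg_right hu3.2.2.le hc.le)
      have h2 : |(u : Fin (d + 1) → ℤ) j.succ| ≤ ⌊t / c⌋ := Int.le_floor.2 (by exact_mod_cast h1)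
      rw [← Int.natCast_floor_eq_floor (by positivity)] at h2
      exact Finset.mem_Icc.2 (abs_le.1 h2)
    refine (Finset.card_le_card hsub).trans ?_
    rw [Fintype.card_piFinset]
    simp only [Int.card_Icc, Finset.prod_const, Finset.card_univ, Fintype.card_fin]
    refine Nat.pow_le_pow_left ?_ d
    omega
  have hcard := Finset.card_le_mul_card_image F _ hfiber
  have hcard' : F.card ≤ (⌊D⌋₊ + 1) * (2 * ⌊t / c⌋₊ + 1) ^ d :=
    hcard.trans (Nat.mul_le_mul_left _ himage)
  have h1 : ((⌊D⌋₊ : ℝ) + 1) ≤ (1 / |a.vec 0| + 1) * (1 + (t - s)) := by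
    have := Nat.floor_le hD0
    have h0 : 0 < 1 / |a.vec 0| := by positivity
    have e : D = (1 / |a.vec 0|) * (t - s) := by rw [hD]; ring
    nlinarith
  have h2 : (2 * (⌊t / c⌋₊ : ℝ) + 1) ≤ (2 / c + 1) * (1 + t) := by
    have := Nat.floor_le (show 0 ≤ t / c by positivity)
    have h0 : 0 < 1 / c := by positivity
    have e : t / c = (1 / c) * t := by ring
    have e' : 2 / c = 2 * (1 / c) := by ring
    rw [e']
    nlinarith
  calc (F.card : ℝ) ≤ ((⌊D⌋₊ : ℝ) + 1) * (2 * (⌊t / c⌋₊ : ℝ) + 1) ^ d := by exact_mod_cast hcard'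
    _ ≤ ((1 / |a.vec 0| + 1) * (1 + (t - s))) * ((2 / c + 1) * (1 + t)) ^ d := by
        gcongr
    _ = _ := by rw [mul_pow]; ring

/-- The form in which slabs are used: shifting the cut-off by a bounded amount costs only order `y ^
d`, uniformly in `T`. -/
theorem IsPointedSemigroup.exists_cnt_le_add (hS : IsPointedSemigroup S) :
    ∃ K : ℝ, 0 ≤ K ∧ ∀ T ⊆ S, ∀ x y : ℝ, x ≤ y → 0 ≤ y →
      (cnt T y : ℝ) ≤ cnt T x + K * (1 + (y - x)) * (1 + y) ^ d := by
  obtain ⟨K, hK, h⟩ := hS.ncard_slab_le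
  refine ⟨K, hK, fun T hT x y hxy hy => ?_⟩
  have hsub : {u ∈ T | pairing a u < y} ⊆
      {u ∈ T | pairing a u < x} ∪ {u ∈ S | x ≤ pairing a u ∧ pairing a u < y} := by
    rintro u ⟨hu, huy⟩
    rcases lt_or_ge (pairing a u) x with hx | hx
    · exact Or.inl ⟨hu, hx⟩
    · exact Or.inr ⟨hT hu, hx, huy⟩
  have hfin : ({u ∈ T | pairing a u < x} ∪
      {u ∈ S | x ≤ pairing a u ∧ pairing a u < y}).Finite :=
    (hS.finite_lt_of_subset hT x).union ((hS.finite_lt y).subset fun u hu => ⟨hu.1, hu.2.2⟩)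
  have h1 : cnt T y ≤ cnt T x + {u ∈ S | x ≤ pairing a u ∧ pairing a u < y}.ncard :=
    (Set.ncard_le_ncard hsub hfin).trans (Set.ncard_union_le _ _)
  have h2 := h x y hxy hy
  have h3 : (cnt T y : ℝ) ≤ cnt T x + ({u ∈ S | x ≤ pairing a u ∧ pairing a u < y}.ncard : ℝ) := by
    exact_mod_cast h1
  linarith

theorem cnt_eq_zero (hS : IsPointedSemigroup S) {T : Set (WLattice a)} (hT : T ⊆ S) {x : ℝ}
    (hx : x ≤ 0) : cnt T x = 0 := by
  rw [cnt, Set.ncard_eq_zero (hS.finite_lt_of_subset hT x)]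
  ext u
  simp only [Set.mem_ofPred_eq, Set.mem_empty_iff_false, iff_false, not_and, not_lt]
  exact fun hu => hx.trans (hS.pairing_nonneg (hT hu))

theorem IsPointedSemigroup.exists_cnt_le (hS : IsPointedSemigroup S) :
    ∃ K : ℝ, 0 ≤ K ∧ ∀ T ⊆ S, ∀ y : ℝ, 0 ≤ y → (cnt T y : ℝ) ≤ K * (1 + y) ^ (d + 1) := by
  obtain ⟨K, hK, h⟩ := hS.exists_cnt_le_add
  refine ⟨K, hK, fun T hT y hy => ?_⟩
  have := h T hT 0 y hy hy
  rw [cnt_eq_zero hS hT le_rfl] at this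
  simp only [Nat.cast_zero, sub_zero, zero_add] at this
  rw [pow_succ]
  linarith

/-- An ideal `T'` of the semigroup that contains a translate of `n • T` has at least `n ^ d` times
as many elements as `T`, up to a change of the bound. -/
theorem IsPointedSemigroup.exists_pow_mul_cnt_le (hS : IsPointedSemigroup S) :
    ∃ C : ℝ, 0 ≤ C ∧ ∀ (T T' : Set (WLattice a)) (n : ℕ) (z : WLattice a) (x : ℝ),
      T' ⊆ S → (∀ u ∈ T', ∀ s ∈ S, u + s ∈ T') → (∀ u ∈ T, n • u + z ∈ T') →
      {u ∈ T | pairing a u < x}.Finite →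
      n ^ (d + 1) * cnt T x ≤ cnt T' (n * x + n * C + pairing a z) := by
  obtain ⟨w, hw, hcube⟩ := hS.exists_cube
  refine ⟨pairing a w + ∑ i, |a.vec i|, add_nonneg (hS.pairing_nonneg hw)
    (Finset.sum_nonneg fun i _ => abs_nonneg _), fun T T' n z x hT' hideal hsub hfin => ?_⟩
  rcases Nat.eq_zero_or_pos n with rfl | hn
  · simp
  let P : Finset (Fin (d + 1) → ℕ) := Fintype.piFinset fun _ => Finset.range n
  have hP : P.card = n ^ (d + 1) := by
    simp [P, Fintype.card_piFinset]
  -- Each point of `n • T + z` is thickened to a cube of side `n`. The cubes at distinct points are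
  -- disjoint, because `k` is recovered modulo `n`.
  let g : WLattice a × (Fin (d + 1) → ℕ) → WLattice a :=
    fun q => (n • q.1 + z) + (n • w + natVec a q.2)
  have hfin' := hS.finite_lt_of_subset hT' (n * x + n * (pairing a w + ∑ i, |a.vec i|) + pairing a z)
  rw [cnt, cnt, Set.ncard_eq_toFinset_card _ hfin, Set.ncard_eq_toFinset_card _ hfin', ← hP,
    mul_comm, ← Finset.card_product]
  refine Finset.card_le_card_of_injOn g ?_ ?_
  · rintro ⟨u, k⟩ huk
    simp only [Finset.coe_product, Set.mem_prod, Finset.mem_coe, Set.Finite.mem_toFinset,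
      Set.mem_ofPred_eq, P, Fintype.mem_piFinset, Finset.mem_range] at huk
    obtain ⟨⟨hu, hux⟩, hk⟩ := huk
    rw [Finset.mem_coe, Set.Finite.mem_toFinset]
    refine ⟨hideal _ (hsub u hu) _ (hcube n k fun i => (hk i).le), ?_⟩
    have hk' : pairing a (natVec a k) ≤ n * ∑ i, |a.vec i| := by
      rw [pairing_natVec, Finset.mul_sum]
      refine Finset.sum_le_sum fun i _ => ?_
      refine (mul_le_mul_of_nonneg_left (le_abs_self _) (Nat.cast_nonneg _)).trans ?_
      gcongr
      exact (hk i).le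
    simp only [g, map_add, map_nsmul, nsmul_eq_mul]
    have : (n : ℝ) * pairing a u < n * x := by
      have : (0 : ℝ) < n := by exact_mod_cast hn
      exact mul_lt_mul_of_pos_left hux this
    linarith
  · rintro ⟨u, k⟩ huk ⟨v, l⟩ hvl h
    simp only [Finset.coe_product, Set.mem_prod, Finset.mem_coe, P, Fintype.mem_piFinset,
      Finset.mem_range] at huk hvl
    have hcoord : ∀ i, (n : ℤ) * (u : Fin (d + 1) → ℤ) i + k i =
        n * (v : Fin (d + 1) → ℤ) i + l i := by
      intro i
      have h1 : n • u + natVec a k = n • v + natVec a l := by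
        have : n • u + natVec a k + (z + n • w) = n • v + natVec a l + (z + n • w) := by
          simp only [g] at h
          calc _ = n • u + z + (n • w + natVec a k) := by abel
            _ = n • v + z + (n • w + natVec a l) := h
            _ = _ := by abel
        exact add_right_cancel this
      have h2 := congrFun (show (n • u + natVec a k : Fin (d + 1) → ℤ) = _ from h1) i
      rw [coe_add, coe_add, coe_nsmul, coe_nsmul] at h2
      exact h2
    have hkl : ∀ i, k i = l i := by
      intro i
      have h1 : ((n : ℤ) * (u : Fin (d + 1) → ℤ) i + k i) % n = k i := by
        rw [Int.mul_add_emod_self_left]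
        exact Int.emod_eq_of_lt (by positivity) (by exact_mod_cast huk.2 i)
      have h2 : ((n : ℤ) * (v : Fin (d + 1) → ℤ) i + l i) % n = l i := by
        rw [Int.mul_add_emod_self_left]
        exact Int.emod_eq_of_lt (by positivity) (by exact_mod_cast hvl.2 i)
      rw [hcoord i, h2] at h1
      exact_mod_cast h1.symm
    refine Prod.ext ?_ (funext hkl)
    funext i
    have := hcoord i
    rw [hkl i] at this
    have hn' : (n : ℤ) ≠ 0 := by exact_mod_cast hn.ne'
    exact mul_left_cancel₀ hn' (add_right_cancel this)

end Slab

end OKVal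

/-! ### Convergence of normalized counts. -/

/-- A bounded sequence that is asymptotically bounded below by each of its terms, up to errors that
tend to `0`, converges. -/
theorem exists_tendsto_of_eventually_sub_le {x ε : ℕ → ℝ} {b B : ℝ}
    (hb : ∀ᶠ i in atTop, b ≤ x i) (hB : ∀ᶠ i in atTop, x i ≤ B)
    (hε : Tendsto ε atTop (𝓝 0))
    (h : ∀ᶠ i in atTop, ∃ y : ℕ → ℝ, Tendsto y atTop (𝓝 (x i - ε i)) ∧ ∀ᶠ j in atTop, y j ≤ x j) :
    ∃ L, Tendsto x atTop (𝓝 L) := by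
  have hbdd : IsBoundedUnder (· ≥ ·) atTop x := ⟨b, by simpa using hb⟩
  have hBdd : IsBoundedUnder (· ≤ ·) atTop x := ⟨B, by simpa using hB⟩
  -- Every term satisfies `x i ≤ liminf x + ε i` eventually, so limsup and liminf agree.
  refine ⟨liminf x atTop, tendsto_of_le_liminf_of_limsup_le le_rfl ?_ hBdd hbdd⟩
  have key : ∀ᶠ i in atTop, x i ≤ liminf x atTop + ε i := by
    filter_upwards [h] with i hi
    obtain ⟨y, hy, hyx⟩ := hi
    have h1 : liminf y atTop ≤ liminf x atTop :=
      liminf_le_liminf hyx hy.isBoundedUnder_ge hBdd.isCoboundedUnder_ge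
    rw [hy.liminf_eq] at h1
    linarith
  have hlim : Tendsto (fun i => liminf x atTop + ε i) atTop (𝓝 (liminf x atTop)) := by
    simpa using hε.const_add (liminf x atTop)
  have h2 := limsup_le_limsup key hbdd.isCoboundedUnder_le hlim.isBoundedUnder_le
  rwa [hlim.limsup_eq] at h2

theorem tendsto_natDiv_div {s : ℕ → ℕ} (hs : Tendsto s atTop atTop) {m : ℕ} :
    Tendsto (fun j => ((s j / m : ℕ) : ℝ) / s j) atTop (𝓝 (1 / m)) := by
  have h := (tendsto_nat_floor_mul_div_atTop (R := ℝ) (a := 1 / m) (by positivity)).comp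
    (tendsto_natCast_atTop_atTop.comp hs)
  refine h.congr fun j => ?_
  simp only [Function.comp]
  rw [one_div_mul_eq_div, Nat.floor_div_natCast, Nat.floor_natCast]

namespace OKVal

variable {d : ℕ} {a : Weight (d + 1)} {S : Set (WLattice a)}

/-- With `i` fixed and `n = s j / s i`, the inclusion of `n • T i + z` in `T j` bounds the
normalized count at `j` below by the one at `i`, minus a slab. The translation `z` may cost a
constant depending on `i` plus `C' * n`, with `C'` uniform: relative to `s j` this tends to `C' / s
i`, which vanishes as `i` grows. -/
theorem IsPointedSemigroup.exists_tendsto_cnt (hS : IsPointedSemigroup S) {s : ℕ → ℕ}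
    (hs : Tendsto s atTop atTop) (T : ℕ → Set (WLattice a)) (hTS : ∀ i, T i ⊆ S)
    (hideal : ∀ i, ∀ u ∈ T i, ∀ v ∈ S, u + v ∈ T i) (C' : ℝ)
    (hT : ∀ i, 0 < s i → ∃ c : ℝ, ∀ᶠ j in atTop, ∃ z : WLattice a,
      pairing a z ≤ c + C' * (s j / s i : ℕ) ∧ ∀ u ∈ T i, (s j / s i) • u + z ∈ T j)
    {t : ℝ} (ht : 0 ≤ t) :
    ∃ L : ℝ, Tendsto (fun j => (cnt (T j) (t * s j) : ℝ) / (s j : ℝ) ^ (d + 1)) atTop (𝓝 L) := by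
  obtain ⟨K, hK, hslab⟩ := hS.exists_cnt_le_add
  obtain ⟨K', hK', hbound⟩ := hS.exists_cnt_le
  obtain ⟨C, hC, hmul⟩ := hS.exists_pow_mul_cnt_le
  set C₁ := C + |C'| with hC₁
  have hC₁0 : 0 ≤ C₁ := by positivity
  have hpos : ∀ᶠ j in atTop, 0 < s j := hs.eventually_gt_atTop 0
  have hsR : Tendsto (fun j => (s j : ℝ)) atTop atTop := tendsto_natCast_atTop_atTop.comp hs
  have hinv : Tendsto (fun j => (1 : ℝ) / s j) atTop (𝓝 0) :=
    (tendsto_const_nhds).div_atTop hsR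
  refine exists_tendsto_of_eventually_sub_le (b := 0) (B := K' * (1 + t) ^ (d + 1))
    -- The limit, as `j` grows, of the normalized slab between `t * s j` and `t * s j + |c| + C₁ *
    -- n`.
    (ε := fun i => K * (C₁ * (1 / s i)) * (t + C₁ * (1 / s i)) ^ d)
    (Eventually.of_forall fun i => by positivity) ?_ ?_ ?_
  · filter_upwards [hpos] with j hj
    have hj' : (1 : ℝ) ≤ s j := by exact_mod_cast hj
    rw [div_le_iff₀ (by positivity), mul_assoc, ← mul_pow]
    refine (hbound (T j) (hTS j) _ (by positivity)).trans ?_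
    gcongr
    linarith
  · have h1 : Tendsto (fun i => C₁ * (1 / (s i : ℝ))) atTop (𝓝 0) := by
      simpa using hinv.const_mul C₁
    have := (h1.const_mul K).mul ((h1.const_add t).pow d)
    simpa using this
  · filter_upwards [hpos] with i hi
    obtain ⟨c, hc⟩ := hT i hi
    set m := s i with hm
    have hmR : (0 : ℝ) < m := by exact_mod_cast hi
    let ρ : ℕ → ℝ := fun j => ((s j / m : ℕ) : ℝ) / s j
    have hρ : Tendsto ρ atTop (𝓝 (1 / m)) := tendsto_natDiv_div hs
    refine ⟨fun j => ρ j ^ (d + 1) * cnt (T i) (t * m)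
      - K * ((1 + |c|) * (1 / s j) + C₁ * ρ j) *
        ((1 + |c|) * (1 / s j) + t + C₁ * ρ j) ^ d, ?_, ?_⟩
    · have hA : Tendsto (fun j => (1 + |c|) * (1 / (s j : ℝ)) + C₁ * ρ j) atTop
          (𝓝 (C₁ * (1 / m))) := by
        simpa using (hinv.const_mul (1 + |c|)).add (hρ.const_mul C₁)
      have hB : Tendsto (fun j => (1 + |c|) * (1 / (s j : ℝ)) + t + C₁ * ρ j) atTop
          (𝓝 (t + C₁ * (1 / m))) := by
        simpa using ((hinv.const_mul (1 + |c|)).add_const t).add (hρ.const_mul C₁)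
      have := ((hρ.pow (d + 1)).mul_const (cnt (T i) (t * m) : ℝ)).sub
        ((hA.const_mul K).mul (hB.pow d))
      rwa [one_div_pow, one_div_mul_eq_div] at this
    · filter_upwards [hc, hpos] with j hj hj0
      obtain ⟨z, hz, hzT⟩ := hj
      have hj' : (0 : ℝ) < s j := by exact_mod_cast hj0
      set n := s j / m with hn
      have h1 := hmul (T i) (T j) n z (t * m) (hTS j) (hideal j) hzT
        (hS.finite_lt_of_subset (hTS i) _)
      have hnm : (n : ℝ) * m ≤ s j := by exact_mod_cast Nat.div_mul_le_self (s j) m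
      have hz' : pairing a z ≤ |c| + |C'| * n := by
        refine hz.trans (add_le_add (le_abs_self _) ?_)
        exact mul_le_mul_of_nonneg_right (le_abs_self _) (Nat.cast_nonneg _)
      have h2 : (n : ℝ) * (t * m) + n * C + pairing a z ≤ t * s j + (|c| + C₁ * n) := by
        have : t * (n * m) ≤ t * s j := mul_le_mul_of_nonneg_left hnm ht
        rw [hC₁]
        nlinarith
      have h3 := hS.cnt_mono (subset_refl (T j)) (hTS j) h2
      have h4 := hslab (T j) (hTS j) (t * s j) (t * s j + (|c| + C₁ * n))
        (by have : 0 ≤ |c| + C₁ * n := by positivity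
            linarith) (by positivity)
      have h5 : (n : ℝ) ^ (d + 1) * cnt (T i) (t * m) ≤
          cnt (T j) (t * s j + (|c| + C₁ * n)) := by exact_mod_cast h1.trans h3
      rw [le_div_iff₀ (by positivity)]
      have e1 : ρ j * s j = n := div_mul_cancel₀ _ hj'.ne'
      have e2 : (1 + |c|) * (1 / (s j : ℝ)) * s j = 1 + |c| := by field_simp
      calc _ = (ρ j * s j) ^ (d + 1) * cnt (T i) (t * m)
            - K * ((1 + |c|) * (1 / (s j : ℝ)) * s j + C₁ * (ρ j * s j)) *
              ((1 + |c|) * (1 / (s j : ℝ)) * s j + t * s j + C₁ * (ρ j * s j)) ^ d := by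
            rw [mul_pow (ρ j), show (1 + |c|) * (1 / (s j : ℝ)) * s j + t * s j + C₁ * (ρ j * s j)
              = ((1 + |c|) * (1 / (s j : ℝ)) + t + C₁ * ρ j) * s j by ring, mul_pow _ (s j : ℝ) d]
            ring
        _ ≤ cnt (T j) (t * s j) := by
            rw [e1, e2]
            have e3 : 1 + (t * s j + (|c| + C₁ * n) - t * s j) = 1 + |c| + C₁ * n := by ring
            have e4 : 1 + (t * s j + (|c| + C₁ * n)) = 1 + |c| + t * s j + C₁ * n := by ring
            rw [e3, e4] at h4
            linarith

/-- The semigroup has at least `ε x ^ (d + 1)` elements of pairing less than `x`. -/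
theorem IsPointedSemigroup.exists_le_cnt (hS : IsPointedSemigroup S) :
    ∃ ε : ℝ, 0 < ε ∧ ∃ x₀ : ℝ, ∀ x, x₀ ≤ x → ε * x ^ (d + 1) ≤ cnt S x := by
  obtain ⟨C, hC, hmul⟩ := hS.exists_pow_mul_cnt_le
  have hC1 : 0 < C + 1 := by linarith
  refine ⟨(1 / (2 * (C + 1))) ^ (d + 1), by positivity, C + 1, fun x hx => ?_⟩
  have hx0 : 0 < x := by linarith
  set n := ⌊x / (C + 1)⌋₊ with hn
  -- A single cube attached to the origin already gives the right order of growth.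
  have h1 := hmul {0} S n 0 1 subset_rfl (fun u hu v hv => hS.add_mem u hu v hv)
    (by simpa using hS.zero_mem) ((Set.finite_singleton _).subset fun u hu => hu.1)
  have h2 : cnt ({0} : Set (WLattice a)) 1 = 1 := by
    rw [cnt, Set.ncard_eq_one]
    refine ⟨0, ?_⟩
    ext u
    simp only [Set.mem_singleton_iff, Set.mem_ofPred_eq, and_iff_left_iff_imp]
    rintro rfl
    simp
  have hnx : (n : ℝ) * (C + 1) ≤ x := by
    have := Nat.floor_le (show 0 ≤ x / (C + 1) by positivity)
    rwa [← le_div_iff₀ hC1]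
  rw [h2, mul_one, map_zero, add_zero] at h1
  have h3 := h1.trans (hS.cnt_mono (subset_refl S) subset_rfl
    (show (n : ℝ) * 1 + n * C ≤ x by linarith))
  have h4 : x / (2 * (C + 1)) ≤ n := by
    have h5 : 1 ≤ x / (C + 1) := by rwa [le_div_iff₀ hC1, one_mul]
    have h6 := Nat.lt_floor_add_one (x / (C + 1))
    have h7 : (1 : ℝ) ≤ n := by
      have : 1 ≤ n := Nat.le_floor (by simpa using h5)
      exact_mod_cast this
    have h8 : x / (2 * (C + 1)) = (x / (C + 1)) / 2 := by field_simp
    rw [h8]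
    linarith
  calc _ = (x / (2 * (C + 1))) ^ (d + 1) := by rw [← mul_pow]; congr 1; ring
    _ ≤ (n : ℝ) ^ (d + 1) := by gcongr
    _ ≤ cnt S x := by exact_mod_cast h3

end OKVal

/-! ### Lengths of quotients and the filtration by values. -/

theorem Submodule.length_quotient_eq_add_length_range {R E κ : Type*} [CommRing R] [AddCommGroup E]
    [Module R E] [AddCommGroup κ] [Module R κ] {N M : Submodule R E} (hNM : N ≤ M) (g : M →ₗ[R] κ)
    (hg : ∀ m : M, g m = 0 ↔ (m : E) ∈ N) :
    Module.length R (E ⧸ N) = Module.length R (E ⧸ M) + Module.length R (LinearMap.range g) := by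
  have hker : LinearMap.ker (N.mkQ ∘ₗ M.subtype) = LinearMap.ker g := by
    ext m
    simp [hg]
  let f : (M ⧸ LinearMap.ker g) →ₗ[R] E ⧸ N :=
    (LinearMap.ker g).liftQ (N.mkQ ∘ₗ M.subtype) hker.ge
  have hf : Function.Injective f := by
    rw [← LinearMap.ker_eq_bot]
    exact Submodule.ker_liftQ_eq_bot _ _ _ hker.le
  have hexact : Function.Exact f (Submodule.factor hNM) := by
    rw [LinearMap.exact_iff]
    ext x
    obtain ⟨x, rfl⟩ := N.mkQ_surjective x
    rw [LinearMap.mem_ker, LinearMap.mem_range]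
    change (Submodule.Quotient.mk x : E ⧸ M) = 0 ↔ ∃ y, f y = Submodule.Quotient.mk x
    rw [Submodule.Quotient.mk_eq_zero]
    constructor
    · intro hx
      exact ⟨Submodule.Quotient.mk ⟨x, hx⟩, rfl⟩
    · rintro ⟨y, hy⟩
      obtain ⟨y, rfl⟩ := Submodule.mkQ_surjective _ y
      have hy' : (Submodule.Quotient.mk (y : E) : E ⧸ N) = Submodule.Quotient.mk x := hy
      rw [Submodule.Quotient.eq] at hy'
      have := M.sub_mem y.2 (hNM hy')
      simpa using this
  rw [Module.length_eq_add_of_exact f (Submodule.factor hNM) hf (Submodule.factor_surjective hNM)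
    hexact, add_comm, (LinearMap.quotKerEquivRange g).length_eq]

namespace OKVal

section Val

variable {R : Type*} [CommRing R] {d : ℕ} {a : Weight d}

/-- The value of a nonzero element, as an element of the lattice. -/
def val (ν : FracValuation R a) (x : FractionRing R) : WLattice a := (ν x).untopD 0

theorem val_eq {ν : FracValuation R a} {x : FractionRing R} {u : WLattice a} (h : ν x = u) :
    val ν x = u := by
  rw [val, h, WithTop.untopD_coe]

theorem ne_zero_of_apply_eq_coe {ν : FracValuation R a} {x : FractionRing R} {u : WLattice a}
    (h : ν x = u) : x ≠ 0 := by
  rintro rfl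
  rw [AddValuation.map_zero] at h
  exact WithTop.coe_ne_top h.symm

theorem algebraMap_ne_zero {r : R} (hr : r ≠ 0) : algebraMap R (FractionRing R) r ≠ 0 :=
  (map_ne_zero_iff _ (IsFractionRing.injective R (FractionRing R))).2 hr

/-- The set of values of the nonzero elements of an ideal. -/
def valueSet (ν : FracValuation R a) (M : Ideal R) : Set (WLattice a) :=
  {u | ∃ r ∈ M, r ≠ 0 ∧ ν (algebraMap R (FractionRing R) r) = u}

theorem valueSet_subset (ν : FracValuation R a) (M : Ideal R) : valueSet ν M ⊆ valueSemigroup ν :=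
  fun _ ⟨r, _, hr0, hr⟩ => ⟨r, hr0, hr⟩

variable [IsDomain R]

theorem coe_val (ν : FracValuation R a) {x : FractionRing R} (hx : x ≠ 0) :
    (val ν x : WithTop (WLattice a)) = ν x := by
  obtain ⟨u, hu⟩ := WithTop.ne_top_iff_exists.1 ((AddValuation.ne_top_iff ν).2 hx)
  rw [val, ← hu, WithTop.untopD_coe]

theorem val_mul (ν : FracValuation R a) {x y : FractionRing R} (hx : x ≠ 0) (hy : y ≠ 0) :
    val ν (x * y) = val ν x + val ν y := by
  apply WithTop.coe_injective
  rw [coe_val ν (mul_ne_zero hx hy), AddValuation.map_mul, WithTop.coe_add, coe_val ν hx,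
    coe_val ν hy]

theorem val_div (ν : FracValuation R a) {x y : FractionRing R} (hx : x ≠ 0) (hy : y ≠ 0) :
    val ν (x / y) = val ν x - val ν y := by
  rw [eq_sub_iff_add_eq, ← val_mul ν (div_ne_zero hx hy) hy, div_mul_cancel₀ x hy]

theorem coe_le_apply_iff {ν : FracValuation R a} {x : FractionRing R} (hx : x ≠ 0)
    {u : WLattice a} : (u : WithTop (WLattice a)) ≤ ν x ↔ pairing a u ≤ pairing a (val ν x) := by
  rw [← coe_val ν hx, WithTop.coe_le_coe, le_iff]

theorem zero_le_apply_iff {ν : FracValuation R a} {x : FractionRing R} (hx : x ≠ 0) :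
    0 ≤ ν x ↔ 0 ≤ pairing a (val ν x) := by
  rw [← WithTop.coe_zero, coe_le_apply_iff hx, map_zero]

theorem zero_lt_apply_iff {ν : FracValuation R a} {x : FractionRing R} (hx : x ≠ 0) :
    0 < ν x ↔ 0 < pairing a (val ν x) := by
  rw [← coe_val ν hx, ← WithTop.coe_zero, WithTop.coe_lt_coe, ← not_le, le_iff, map_zero, not_le]

/-- The value of a nonzero element of `R`, paired with the weight vector. -/
def wt (ν : FracValuation R a) (r : R) : ℝ := pairing a (val ν (algebraMap R (FractionRing R) r))

theorem wt_mul (ν : FracValuation R a) {r s : R} (hr : r ≠ 0) (hs : s ≠ 0) :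
    wt ν (r * s) = wt ν r + wt ν s := by
  rw [wt, map_mul, val_mul ν (algebraMap_ne_zero hr) (algebraMap_ne_zero hs), map_add]
  rfl

theorem val_mem_valueSet (ν : FracValuation R a) {M : Ideal R} {r : R} (hr : r ∈ M) (hr0 : r ≠ 0) :
    val ν (algebraMap R (FractionRing R) r) ∈ valueSet ν M :=
  ⟨r, hr, hr0, (coe_val ν (algebraMap_ne_zero hr0)).symm⟩

omit [IsDomain R] in
theorem valueSet_top (ν : FracValuation R a) : valueSet ν ⊤ = valueSemigroup ν :=
  Set.Subset.antisymm (valueSet_subset ν ⊤) fun _ ⟨r, hr0, hr⟩ => ⟨r, trivial, hr0, hr⟩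

theorem valueSet_add_mem {ν : FracValuation R a} {M N P : Ideal R} (h : M * N ≤ P)
    {u v : WLattice a} (hu : u ∈ valueSet ν M) (hv : v ∈ valueSet ν N) : u + v ∈ valueSet ν P := by
  obtain ⟨r, hr, hr0, hru⟩ := hu
  obtain ⟨s, hs, hs0, hsv⟩ := hv
  exact ⟨r * s, h (Ideal.mul_mem_mul hr hs), mul_ne_zero hr0 hs0, by
    rw [map_mul, AddValuation.map_mul, hru, hsv, WithTop.coe_add]⟩

theorem valueSet_add_mem_self {ν : FracValuation R a} {M : Ideal R} :
    ∀ u ∈ valueSet ν M, ∀ v ∈ valueSemigroup ν, u + v ∈ valueSet ν M := fun u hu v hv =>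
  valueSet_add_mem (N := ⊤) Ideal.mul_le_left hu (by rwa [valueSet_top])

variable [IsLocalRing R] {ν : FracValuation R a}

/-- The ideal of the elements of weight at least `t`. -/
def Dominates.ideal (h : Dominates ν) (t : ℝ) : Ideal R where
  -- Testing against lattice elements above `ν r` makes the condition vacuous for `r = 0`, whose
  -- value is `⊤`, and allows any real threshold.
  carrier := {r | ∀ u : WLattice a, ν (algebraMap R (FractionRing R) r) ≤ u → t ≤ pairing a u}
  zero_mem' u hu := by
    rw [map_zero, AddValuation.map_zero] at hu
    exact absurd (top_le_iff.1 hu) WithTop.coe_ne_top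
  add_mem' {r s} hr hs u hu := by
    rw [map_add] at hu
    rcases min_le_iff.1 ((AddValuation.map_add ν _ _).trans hu) with h | h
    exacts [hr u h, hs u h]
  smul_mem' s r hr u hu := by
    rw [smul_eq_mul, map_mul, AddValuation.map_mul] at hu
    exact hr u ((le_add_of_nonneg_left (h.nonneg s)).trans hu)

theorem Dominates.mem_ideal (h : Dominates ν) {t : ℝ} {r : R} (hr : r ≠ 0) :
    r ∈ h.ideal t ↔ t ≤ wt ν r := by
  constructor
  · intro hrt
    exact hrt _ (coe_val ν (algebraMap_ne_zero hr)).ge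
  · intro ht u hu
    rw [← coe_val ν (algebraMap_ne_zero hr), WithTop.coe_le_coe, le_iff] at hu
    exact ht.trans hu

omit [IsDomain R] in
theorem Dominates.ideal_anti (h : Dominates ν) {s t : ℝ} (hst : s ≤ t) : h.ideal t ≤ h.ideal s :=
  fun _ hr u hu => hst.trans (hr u hu)

theorem Dominates.wt_nonneg (h : Dominates ν) {r : R} (hr : r ≠ 0) : 0 ≤ wt ν r :=
  (zero_le_apply_iff (algebraMap_ne_zero hr)).1 (h.nonneg r)

theorem Dominates.ideal_eq_top (h : Dominates ν) {t : ℝ} (ht : t ≤ 0) : h.ideal t = ⊤ := by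
  refine eq_top_iff.2 fun r _ => ?_
  rcases eq_or_ne r 0 with rfl | hr
  · exact zero_mem _
  · exact (h.mem_ideal hr).2 (ht.trans (h.wt_nonneg hr))

/-- The residue field of `ν`, as a module over `R`. -/
def Dominates.ResidueModule (_h : Dominates ν) : Type _ := IsLocalRing.ResidueField (valRing ν)

instance (h : Dominates ν) : AddCommGroup h.ResidueModule :=
  inferInstanceAs (AddCommGroup (IsLocalRing.ResidueField (valRing ν)))

instance (h : Dominates ν) : Nontrivial h.ResidueModule :=
  inferInstanceAs (Nontrivial (IsLocalRing.ResidueField (valRing ν)))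

instance (h : Dominates ν) : Module R h.ResidueModule :=
  Module.compHom (IsLocalRing.ResidueField (valRing ν))
    ((IsLocalRing.residue (valRing ν)).comp h.inclusion)

/-- The residue class of an element of the valuation ring. -/
def Dominates.res (h : Dominates ν) (y : valRing ν) : h.ResidueModule :=
  IsLocalRing.residue (valRing ν) y

theorem Dominates.res_add (h : Dominates ν) (y z : valRing ν) :
    h.res (y + z) = h.res y + h.res z := map_add (IsLocalRing.residue (valRing ν)) y z

theorem Dominates.res_smul (h : Dominates ν) (r : R) (y : valRing ν) :
    h.res (h.inclusion r * y) = r • h.res y := map_mul (IsLocalRing.residue (valRing ν)) _ y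

theorem Dominates.res_eq_zero_iff (h : Dominates ν) (y : valRing ν) :
    h.res y = 0 ↔ 0 < ν (y : FractionRing R) := by
  change IsLocalRing.residue (valRing ν) y = 0 ↔ _
  rw [IsLocalRing.residue_eq_zero_iff]
  exact (Valuation.mem_maximalIdeal_iff (v := AddValuation.toValuation ν) (a := y))

theorem Dominates.res_surjective (h : Dominates ν) : Function.Surjective h.res :=
  IsLocalRing.residue_surjective

theorem Dominates.div_mem_valRing (h : Dominates ν) {x : FractionRing R} (hx : x ≠ 0)
    {r : R} (hr : r ∈ h.ideal (pairing a (val ν x))) :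
    algebraMap R (FractionRing R) r / x ∈ valRing ν := by
  rcases eq_or_ne r 0 with rfl | hr0
  · simp
  have h0 := algebraMap_ne_zero hr0
  rw [mem_valRing, zero_le_apply_iff (div_ne_zero h0 hx), val_div ν h0 hx, map_sub, sub_nonneg]
  exact (h.mem_ideal hr0).1 hr

/-- The map from the elements of value at least `ν x` to the residue field given by division
by `x`. -/
def Dominates.grMap (h : Dominates ν) {x : FractionRing R} (hx : x ≠ 0) :
    h.ideal (pairing a (val ν x)) →ₗ[R] h.ResidueModule where
  toFun r := h.res ⟨_, h.div_mem_valRing hx r.2⟩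
  map_add' r s := by
    rw [← h.res_add]
    congr 1
    ext
    simp [add_div]
  map_smul' c r := by
    rw [RingHom.id_apply, ← h.res_smul]
    congr 1
    ext
    simp only [Submodule.coe_smul, smul_eq_mul, map_mul, Dominates.inclusion]
    exact mul_div_assoc _ _ _

theorem Dominates.grMap_eq_zero_iff (h : Dominates ν) {x : FractionRing R} (hx : x ≠ 0)
    (r : h.ideal (pairing a (val ν x))) :
    h.grMap hx r = 0 ↔ ((r : R) ≠ 0 → pairing a (val ν x) < wt ν (r : R)) := by
  change h.res _ = 0 ↔ _
  rw [h.res_eq_zero_iff]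
  obtain ⟨r, hr⟩ := r
  dsimp only
  rcases eq_or_ne r 0 with rfl | hr0
  · simp
  have h0 := algebraMap_ne_zero hr0
  rw [zero_lt_apply_iff (div_ne_zero h0 hx), val_div ν h0 hx, map_sub, sub_pos]
  exact ⟨fun h _ => h, fun h => h hr0⟩

/-- The restriction of `grMap` to the elements of an ideal. -/
def Dominates.grMapRestrict (h : Dominates ν) {x : FractionRing R} (hx : x ≠ 0) (M : Ideal R) :
    (M ⊓ h.ideal (pairing a (val ν x)) : Ideal R) →ₗ[R] h.ResidueModule :=
  h.grMap hx ∘ₗ Submodule.inclusion inf_le_right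

theorem IsOK.isPointedSemigroup (ok : IsOK ν) : IsPointedSemigroup (valueSemigroup ν) where
  zero_mem := ⟨1, one_ne_zero, by rw [map_one, AddValuation.map_one]; rfl⟩
  add_mem u hu v hv := by
    rw [← valueSet_top] at hu hv ⊢
    exact valueSet_add_mem le_top hu hv
  closure_eq := ok.closure_eq
  cone := by
    obtain ⟨c, hc, -, h⟩ := ok.pointed
    refine ⟨c, hc, fun u hu => ?_⟩
    rw [pairing_eq_inner]
    exact h _ (subset_closure (Submodule.subset_span ⟨u, hu, rfl⟩))

/-- The elements of the value set of `M` of pairing less than `t`. -/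
def IsOK.valuesLT (ok : IsOK ν) (M : Ideal R) (t : ℝ) : Finset (WLattice a) :=
  (ok.isPointedSemigroup.finite_lt_of_subset (valueSet_subset ν M) t).toFinset

theorem IsOK.mem_valuesLT (ok : IsOK ν) {M : Ideal R} {t : ℝ} {u : WLattice a} :
    u ∈ ok.valuesLT M t ↔ u ∈ valueSet ν M ∧ pairing a u < t := by
  rw [IsOK.valuesLT, Set.Finite.mem_toFinset]
  rfl

theorem IsOK.card_valuesLT (ok : IsOK ν) (M : Ideal R) (t : ℝ) :
    (ok.valuesLT M t).card = cnt (valueSet ν M) t :=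
  (Set.ncard_eq_toFinset_card _ _).symm

/-- Only finitely many values of `M` lie below `t`. Each one passed by the filtration adds the
length of its graded piece, namely the image of `M ⊓ ideal u` in the residue field. -/
theorem IsOK.length_quotient_inf_ideal (ok : IsOK ν) (M : Ideal R)
    (x : WLattice a → FractionRing R) (hx0 : ∀ u, x u ≠ 0) (hx : ∀ u, val ν (x u) = u) (t : ℝ) :
    Module.length R (R ⧸ (M ⊓ ok.dominates.ideal t)) = Module.length R (R ⧸ M) +
      ∑ u ∈ ok.valuesLT M t,
        Module.length R (LinearMap.range (ok.dominates.grMapRestrict (hx0 u) M)) := by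
  classical
  obtain ⟨n, hn⟩ : ∃ n, (ok.valuesLT M t).card = n := ⟨_, rfl⟩
  induction n generalizing t with
  | zero =>
    rw [Finset.card_eq_zero] at hn
    have hM : M ≤ ok.dominates.ideal t := by
      intro r hr
      rcases eq_or_ne r 0 with rfl | hr0
      · exact zero_mem _
      rw [ok.dominates.mem_ideal hr0]
      by_contra hlt
      have := ok.mem_valuesLT.2 ⟨val_mem_valueSet ν hr hr0, not_le.1 hlt⟩
      simp [hn] at this
    rw [hn, inf_eq_left.2 hM, Finset.sum_empty, add_zero]
  | succ n ih =>
    have hne : (ok.valuesLT M t).Nonempty := Finset.card_pos.1 (by omega)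
    -- With `u₀` the largest value of `M` below `t`, the elements of `M` of value greater than `u₀`
    -- are exactly those of weight at least `t`.
    obtain ⟨u₀, hu₀, hmax⟩ := Finset.exists_max_image _ (pairing a) hne
    have hu₀' := ok.mem_valuesLT.1 hu₀
    have herase : ok.valuesLT M (pairing a (val ν (x u₀))) = (ok.valuesLT M t).erase u₀ := by
      ext u
      rw [hx, Finset.mem_erase, ok.mem_valuesLT, ok.mem_valuesLT]
      constructor
      · rintro ⟨hu, hlt⟩
        exact ⟨by rintro rfl; exact lt_irrefl _ hlt, hu, hlt.trans hu₀'.2⟩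
      · rintro ⟨hne, hu, hlt⟩
        refine ⟨hu, lt_of_le_of_ne (hmax u (ok.mem_valuesLT.2 ⟨hu, hlt⟩)) ?_⟩
        exact fun h => hne (pairing_injective a h)
    have hstep := Submodule.length_quotient_eq_add_length_range
      (N := M ⊓ ok.dominates.ideal t)
      (M := M ⊓ ok.dominates.ideal (pairing a (val ν (x u₀))))
      (inf_le_inf_left _ (ok.dominates.ideal_anti (by rw [hx]; exact hu₀'.2.le)))
      (ok.dominates.grMapRestrict (hx0 u₀) M) (by
        rintro ⟨r, hrM, hr⟩
        refine (ok.dominates.grMap_eq_zero_iff (hx0 u₀) ⟨r, hr⟩).trans ?_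
        dsimp only
        rcases eq_or_ne r 0 with rfl | hr0
        · simp
        rw [hx, Submodule.mem_inf, ok.dominates.mem_ideal hr0]
        constructor
        · intro hlt
          refine ⟨hrM, ?_⟩
          by_contra h
          have := hmax _ (ok.mem_valuesLT.2 ⟨val_mem_valueSet ν hrM hr0, not_le.1 h⟩)
          exact absurd (hlt hr0) (not_lt.2 this)
        · rintro ⟨-, h⟩ -
          exact hu₀'.2.trans_le h)
    rw [hstep, ih _ (by rw [herase, Finset.card_erase_of_mem hu₀, hn]; rfl), herase, ← Finset.sum_erase_add _ _ hu₀, add_assoc]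

theorem IsOK.exists_lift (ok : IsOK ν) : ∀ u : WLattice a, ∃ x : FractionRing R,
    x ≠ 0 ∧ val ν x = u := fun u => by
  obtain ⟨x, hx⟩ := ok.surjective u
  exact ⟨x, ne_zero_of_apply_eq_coe hx, val_eq hx⟩

theorem IsOK.finite_residueModule (ok : IsOK ν) : Module.Finite R ok.dominates.ResidueModule := by
  have h1 : ((ok.dominates.residueMap).comp (IsLocalRing.residue R)).Finite :=
    ok.residue_finite.comp (RingHom.Finite.of_surjective _ IsLocalRing.residue_surjective)
  exact h1

theorem IsOK.length_residueModule_ne_top (ok : IsOK ν) :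
    Module.length R ok.dominates.ResidueModule ≠ ⊤ := by
  let _ : Module (IsLocalRing.ResidueField R) ok.dominates.ResidueModule :=
    Module.compHom (IsLocalRing.ResidueField (valRing ν)) ok.dominates.residueMap
  have : IsScalarTower R (IsLocalRing.ResidueField R) ok.dominates.ResidueModule :=
    IsScalarTower.of_algebraMap_smul fun r x => rfl
  have : Module.Finite (IsLocalRing.ResidueField R) ok.dominates.ResidueModule :=
    ok.residue_finite
  rw [Module.length_eq_of_surjective (R := IsLocalRing.ResidueField R)
    IsLocalRing.residue_surjective]
  exact Module.length_ne_top

/-- There is a single denominator that suffices to represent all residue classes of `ν` by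
fractions of elements of `R`. -/
theorem IsOK.exists_denominator (ok : IsOK ν) : ∃ b : R, b ≠ 0 ∧ ∀ y : FractionRing R,
    y ∈ valRing ν → ∃ r : R,
      0 < ν (y - algebraMap R (FractionRing R) r / algebraMap R (FractionRing R) b) := by
  classical
  obtain ⟨s, hs⟩ := ok.finite_residueModule.fg_top
  choose lift hlift using ok.dominates.res_surjective
  -- `b` is a common denominator for lifts of finitely many generators of the residue field over
  -- `R`; their `R`-combinations, all of the form `r / b`, hit every class.
  obtain ⟨b, hb⟩ := IsLocalization.exist_integer_multiples_of_finset (nonZeroDivisors R)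
    (s.image fun z => (lift z : FractionRing R))
  have hb0 : (b : R) ≠ 0 := nonZeroDivisors.coe_ne_zero b
  have hb0' := algebraMap_ne_zero hb0
  refine ⟨b, hb0, fun y hy => ?_⟩
  have key : ∀ z ∈ Submodule.span R (s : Set ok.dominates.ResidueModule),
      ∃ y' : valRing ν, ok.dominates.res y' = z ∧ ∃ r : R, (y' : FractionRing R) =
        algebraMap R (FractionRing R) r / algebraMap R (FractionRing R) b := by
    intro z hz
    induction hz using Submodule.span_induction with
    | mem z hz =>
      obtain ⟨r, hr⟩ := hb (lift z) (Finset.mem_image_of_mem _ hz)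
      refine ⟨lift z, hlift z, r, ?_⟩
      rw [eq_div_iff hb0', hr, Algebra.smul_def, mul_comm]
    | zero => exact ⟨0, map_zero (IsLocalRing.residue (valRing ν)), 0, by simp⟩
    | add z z' _ _ h h' =>
      obtain ⟨y, rfl, r, hr⟩ := h
      obtain ⟨y', rfl, r', hr'⟩ := h'
      refine ⟨y + y', ok.dominates.res_add _ _, r + r', ?_⟩
      rw [map_add, add_div, ← hr, ← hr']
      rfl
    | smul c z _ h =>
      obtain ⟨y, rfl, r, hr⟩ := h
      refine ⟨ok.dominates.inclusion c * y, ok.dominates.res_smul _ _, c * r, ?_⟩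
      rw [map_mul, mul_div_assoc, ← hr]
      rfl
  obtain ⟨y', hy', r, hr⟩ := key (ok.dominates.res ⟨y, hy⟩) (by rw [hs]; trivial)
  refine ⟨r, ?_⟩
  rw [← hr]
  have h1 : ok.dominates.res (⟨y, hy⟩ - y') = 0 := by
    have : ok.dominates.res (⟨y, hy⟩ - y') = ok.dominates.res ⟨y, hy⟩ - ok.dominates.res y' :=
      map_sub (IsLocalRing.residue (valRing ν)) _ _
    rw [this, hy', sub_self]
  exact (ok.dominates.res_eq_zero_iff _).1 h1

/-- Take `β` to be the value of the common denominator `b`. If `m` in `M` has value `u`, then `e = m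
* b / x` is a unit of the valuation ring. Approximating `y / e` by `r / b` makes `m * r / x`
congruent to `y`, with `m * r` in `M`. -/
theorem IsOK.exists_range_eq_top (ok : IsOK ν) : ∃ β ∈ valueSemigroup ν, ∀ (M : Ideal R)
    (x : FractionRing R) (hx : x ≠ 0), ∀ u ∈ valueSet ν M, val ν x = u + β →
      LinearMap.range (ok.dominates.grMapRestrict hx M) = ⊤ := by
  obtain ⟨b, hb0, hb⟩ := ok.exists_denominator
  have hb0' := algebraMap_ne_zero hb0
  refine ⟨_, ⟨b, hb0, (coe_val ν hb0').symm⟩, ?_⟩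
  rintro M x hx u ⟨m, hmM, hm0, hmu⟩ hxu
  have hm0' := algebraMap_ne_zero hm0
  rw [LinearMap.range_eq_top]
  intro z
  obtain ⟨⟨y, hy⟩, rfl⟩ := ok.dominates.res_surjective z
  set e := algebraMap R (FractionRing R) m * algebraMap R (FractionRing R) b / x with he
  have he0 : e ≠ 0 := div_ne_zero (mul_ne_zero hm0' hb0') hx
  have hve : ν e = 0 := by
    rw [← coe_val ν he0, he, val_div ν (mul_ne_zero hm0' hb0') hx, val_mul ν hm0' hb0',
      val_eq hmu, hxu, sub_self]
    rfl
  have hve' : ν e⁻¹ = 0 := by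
    have h1 : ν e + ν e⁻¹ = 0 := by
      rw [← AddValuation.map_mul, mul_inv_cancel₀ he0, AddValuation.map_one]
    rwa [hve, zero_add] at h1
  have hy' : y * e⁻¹ ∈ valRing ν := by
    rw [mem_valRing, AddValuation.map_mul, hve', add_zero]
    exact hy
  obtain ⟨r, hr⟩ := hb _ hy'
  have hdiff : 0 < ν (y - algebraMap R (FractionRing R) (m * r) / x) := by
    have : y - algebraMap R (FractionRing R) (m * r) / x =
        e * (y * e⁻¹ - algebraMap R (FractionRing R) r / algebraMap R (FractionRing R) b) := by
      rw [he, map_mul]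
      field_simp
    rw [this, AddValuation.map_mul, hve, zero_add]
    exact hr
  have hmem : algebraMap R (FractionRing R) (m * r) / x ∈ valRing ν := by
    have h1 : y - algebraMap R (FractionRing R) (m * r) / x ∈ valRing ν :=
      (mem_valRing ν _).2 hdiff.le
    simpa using sub_mem hy h1
  have hmr : m * r ∈ ok.dominates.ideal (pairing a (val ν x)) := by
    rcases eq_or_ne (m * r) 0 with h0 | h0
    · rw [h0]; exact zero_mem _
    rw [ok.dominates.mem_ideal h0]
    have h0' := algebraMap_ne_zero h0
    rw [mem_valRing, zero_le_apply_iff (div_ne_zero h0' hx), val_div ν h0' hx, map_sub,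
      sub_nonneg] at hmem
    exact hmem
  refine ⟨⟨m * r, M.mul_mem_right _ hmM, hmr⟩, ?_⟩
  change ok.dominates.res ⟨algebraMap R (FractionRing R) (m * r) / x, _⟩ = _
  have h2 := (ok.dominates.res_eq_zero_iff (⟨y, hy⟩ - ⟨_, hmem⟩)).2 hdiff
  have h3 : ok.dominates.res (⟨y, hy⟩ - ⟨_, hmem⟩) =
      ok.dominates.res ⟨y, hy⟩ - ok.dominates.res ⟨_, hmem⟩ :=
    map_sub (IsLocalRing.residue (valRing ν)) _ _
  rw [h3, sub_eq_zero] at h2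
  exact h2.symm

end Val

end OKVal

/-! ### Colengths as counts of omitted values. -/

namespace OKVal

open IdealFamily

variable {R : Type*} [CommRing R] [IsDomain R] [IsLocalRing R]

/-- Here `h` is the length of the residue field of `ν` over `R`. It bounds every graded piece from
above, and the pieces at `u + β` attain it, whence the shift by `β` in the lower bound. -/
theorem IsOK.exists_sum_length_bounds {d : ℕ} {a : Weight d} {ν : FracValuation R a}
    (ok : IsOK ν) : ∃ (h : ℕ) (β : ℝ) (g : Ideal R → WLattice a → ℕ∞), 0 < h ∧ 0 ≤ β ∧
      (∀ M t, Module.length R (R ⧸ (M ⊓ ok.dominates.ideal t)) = Module.length R (R ⧸ M) +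
        ∑ u ∈ ok.valuesLT M t, g M u) ∧
      (∀ M t, ∑ u ∈ ok.valuesLT M t, g M u ≤ (h * cnt (valueSet ν M) t : ℕ)) ∧
      ∀ M t, ((h * cnt (valueSet ν M) (t - β) : ℕ) : ℕ∞) ≤ ∑ u ∈ ok.valuesLT M t, g M u := by
  classical
  obtain ⟨β, hβ, hrange⟩ := ok.exists_range_eq_top
  choose x hx0 hx using ok.exists_lift
  obtain ⟨h, hh⟩ := ENat.ne_top_iff_exists.1 ok.length_residueModule_ne_top
  refine ⟨h, pairing a β,
    fun M u => Module.length R (LinearMap.range (ok.dominates.grMapRestrict (hx0 u) M)),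
    ?_, ok.isPointedSemigroup.pairing_nonneg hβ,
    fun M t => ok.length_quotient_inf_ideal M x hx0 hx t, fun M t => ?_, fun M t => ?_⟩
  · have : 0 < Module.length R ok.dominates.ResidueModule := Module.length_pos
    rw [← hh] at this
    exact_mod_cast this
  · refine (Finset.sum_le_card_nsmul _ _ (h : ℕ∞) fun u _ => ?_).trans ?_
    · rw [hh]
      exact Module.length_le_of_injective (Submodule.subtype _) (Submodule.subtype_injective _)
    · rw [ok.card_valuesLT, nsmul_eq_mul, mul_comm]
      push_cast
      rfl
  · have hsub : (ok.valuesLT M (t - pairing a β)).image (· + β) ⊆ ok.valuesLT M t := by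
      intro v hv
      obtain ⟨u, hu, rfl⟩ := Finset.mem_image.1 hv
      rw [ok.mem_valuesLT] at hu ⊢
      refine ⟨valueSet_add_mem_self _ hu.1 _ hβ, ?_⟩
      rw [map_add]
      linarith [hu.2]
    refine le_trans (le_of_eq ?_) (Finset.sum_le_sum_of_subset hsub)
    rw [Finset.sum_image fun _ _ _ _ h => add_right_cancel h,
      Finset.sum_congr rfl (g := fun _ => (h : ℕ∞)), Finset.sum_const, ok.card_valuesLT,
      nsmul_eq_mul]
    · push_cast
      rw [mul_comm]
    · intro u hu
      dsimp only
      rw [hrange M _ (hx0 _) u (ok.mem_valuesLT.1 hu).1 (hx _), Module.length_top, hh]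

variable {d : ℕ} {a : Weight (d + 1)} {ν : FracValuation R a}

/-- The colength of an ideal is counted by the values that it omits, up to an error of lower
order. -/
theorem IsOK.exists_colength_estimate (ok : IsOK ν) : ∃ H E : ℝ, 0 < H ∧ 0 ≤ E ∧
    ∀ (M : Ideal R) (t : ℝ), 0 ≤ t → ok.dominates.ideal t ≤ M →
      Module.length R (R ⧸ M) ≠ ⊤ ∧
      |colength M - H * (cnt (valueSemigroup ν) t - cnt (valueSet ν M) t)| ≤ E * (1 + t) ^ d := by
  obtain ⟨h, β, g, hh, hβ, hlen, hle, hge⟩ := ok.exists_sum_length_bounds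
  obtain ⟨K, hK, hslab⟩ := ok.isPointedSemigroup.exists_cnt_le_add
  have hhR : (0 : ℝ) < h := by exact_mod_cast hh
  refine ⟨h, h * (K * (1 + β)), hhR, by positivity, fun M t ht hM => ?_⟩
  have hM1 := hlen M t
  have hT1 := hlen ⊤ t
  have hM2 := hle M t
  have hT2 := hle ⊤ t
  have hM3 := hge M t
  have hT3 := hge ⊤ t
  rw [valueSet_top] at hT2 hT3
  -- The length of `R` modulo `ideal t` is now computed twice, filtering `M` and filtering `R`; the
  -- difference of the two sums is the colength of `M`.
  rw [inf_eq_right.2 hM] at hM1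
  rw [top_inf_eq, Module.length_eq_zero (M := R ⧸ (⊤ : Ideal R)), zero_add] at hT1
  obtain ⟨A, hA⟩ := ENat.ne_top_iff_exists.1 (ne_top_of_le_ne_top (ENat.natCast_ne_top _) hT2)
  obtain ⟨B, hB⟩ := ENat.ne_top_iff_exists.1 (ne_top_of_le_ne_top (ENat.natCast_ne_top _) hM2)
  rw [← hB] at hM1 hM2 hM3
  rw [← hA] at hT1 hT2 hT3
  rw [hT1] at hM1
  have hfin : Module.length R (R ⧸ M) ≠ ⊤ := by
    intro htop
    rw [htop, top_add] at hM1
    exact ENat.natCast_ne_top _ hM1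
  refine ⟨hfin, ?_⟩
  obtain ⟨ℓ, hℓ⟩ := ENat.ne_top_iff_exists.1 hfin
  rw [colength, ← hℓ, ENat.toNat_natCast]
  rw [← hℓ] at hM1
  have e1 : (A : ℝ) = ℓ + B := by exact_mod_cast hM1
  have e2 : (A : ℝ) ≤ h * cnt (valueSemigroup ν) t := by exact_mod_cast hT2
  have e3 : (h : ℝ) * cnt (valueSemigroup ν) (t - β) ≤ A := by exact_mod_cast hT3
  have e4 : (B : ℝ) ≤ h * cnt (valueSet ν M) t := by exact_mod_cast hM2
  have e5 : (h : ℝ) * cnt (valueSet ν M) (t - β) ≤ B := by exact_mod_cast hM3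
  have s1 := mul_le_mul_of_nonneg_left
    (hslab _ subset_rfl (t - β) t (by linarith) ht) hhR.le
  have s2 := mul_le_mul_of_nonneg_left
    (hslab _ (valueSet_subset ν M) (t - β) t (by linarith) ht) hhR.le
  rw [sub_sub_cancel] at s1 s2
  rw [abs_le]
  constructor <;> nlinarith

theorem IsOK.length_ne_top (ok : IsOK ν) {M : Ideal R} {t : ℝ} (h : ok.dominates.ideal t ≤ M) :
    Module.length R (R ⧸ M) ≠ ⊤ := by
  obtain ⟨_, _, _, _, hE⟩ := ok.exists_colength_estimate
  exact (hE M (max t 0) (le_max_right _ _)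
    ((ok.dominates.ideal_anti (le_max_left _ _)).trans h)).1

omit [IsDomain R] [IsLocalRing R] in
theorem colength_anti {M N : Ideal R} (h : M ≤ N) (hM : Module.length R (R ⧸ M) ≠ ⊤) :
    colength N ≤ colength M := by
  rw [colength, colength]
  exact_mod_cast ENat.toNat_le_toNat
    (Module.length_le_of_surjective (Submodule.factor h) (Submodule.factor_surjective h)) hM

/-- The quotient of `R` by a nonzero element has dimension at most `d`. -/
theorem IsOK.exists_colength_sup_le (ok : IsOK ν) : ∃ K : ℝ, 0 ≤ K ∧ ∀ (M : Ideal R) (f : R) (t : ℝ),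
    f ≠ 0 → f ∈ M → 0 ≤ t → ok.dominates.ideal t ≤ M →
      colength M ≤ K * (1 + wt ν f) * (1 + t) ^ d := by
  obtain ⟨H, E, hH, hE, hest⟩ := ok.exists_colength_estimate
  obtain ⟨K, hK, hslab⟩ := ok.isPointedSemigroup.exists_cnt_le_add
  refine ⟨E + H * K, by positivity, fun M f t hf hfM ht hM => ?_⟩
  have hw := ok.dominates.wt_nonneg hf
  have h1 := (abs_le.1 (hest M t ht hM).2).2
  have h2 := hslab _ subset_rfl (t - wt ν f) t (by linarith) ht
  -- Since `f` lies in `M`, its value plus the whole semigroup consists of values of `M`. The values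
  -- missed below `t` are thus no more numerous than the semigroup elements in a slab of width `wt ν
  -- f`.
  have h3 : cnt (valueSemigroup ν) (t - wt ν f) ≤ cnt (valueSet ν M) t := by
    refine Set.ncard_le_ncard_of_injOn
      (fun u => val ν (algebraMap R (FractionRing R) f) + u) ?_ ?_
      (ok.isPointedSemigroup.finite_lt_of_subset (valueSet_subset ν M) t)
    · rintro u ⟨hu, hut⟩
      refine ⟨valueSet_add_mem_self _ (val_mem_valueSet ν hfM hf) _ hu, ?_⟩
      have : pairing a (val ν (algebraMap R (FractionRing R) f)) = wt ν f := rfl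
      rw [map_add, this]
      linarith
    · intro u _ v _ h
      exact add_left_cancel h
  have h3' : (cnt (valueSemigroup ν) (t - wt ν f) : ℝ) ≤ cnt (valueSet ν M) t := by
    exact_mod_cast h3
  rw [sub_sub_cancel] at h2
  have h4 : H * (cnt (valueSemigroup ν) t - cnt (valueSet ν M) t) ≤
      H * (K * (1 + wt ν f) * (1 + t) ^ d) :=
    mul_le_mul_of_nonneg_left (by linarith) hH.le
  have h5 : E * (1 + t) ^ d ≤ E * (1 + wt ν f) * (1 + t) ^ d := by
    have : 0 ≤ E * (1 + t) ^ d := by positivity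
    nlinarith
  nlinarith

/-- Convergence of normalized colengths for families that are compatible with multiplication
by integers on the level of values. -/
theorem IsOK.exists_tendsto_colength (ok : IsOK ν) {s : ℕ → ℕ} (hs : Tendsto s atTop atTop)
    (I : ℕ → Ideal R) {t : ℝ} (ht : 0 ≤ t) (hI : ∀ j, ok.dominates.ideal (t * s j) ≤ I j) (C' : ℝ)
    (hT : ∀ i, 0 < s i → ∃ c : ℝ, ∀ᶠ j in atTop, ∃ z : WLattice a,
      pairing a z ≤ c + C' * (s j / s i : ℕ) ∧
        ∀ u ∈ valueSet ν (I i), (s j / s i) • u + z ∈ valueSet ν (I j)) :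
    ∃ L : ℝ, Tendsto (fun j => colength (I j) / (s j : ℝ) ^ (d + 1)) atTop (𝓝 L) := by
  obtain ⟨H, E, hH, hE, hest⟩ := ok.exists_colength_estimate
  have hS := ok.isPointedSemigroup
  -- The semigroup is closed under multiples, so the constant family needs no translation.
  obtain ⟨L₁, hL₁⟩ := hS.exists_tendsto_cnt hs (fun _ => valueSemigroup ν) (fun _ => subset_rfl)
    (fun _ u hu v hv => hS.add_mem u hu v hv) 0 (fun i _ => ⟨0, Eventually.of_forall fun j =>
      ⟨0, by simp, fun u hu => by simpa using hS.nsmul_mem _ hu⟩⟩) ht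
  obtain ⟨L₂, hL₂⟩ := hS.exists_tendsto_cnt hs (fun j => valueSet ν (I j))
    (fun _ => valueSet_subset ν _) (fun _ => valueSet_add_mem_self) C' hT ht
  refine ⟨H * (L₁ - L₂), ?_⟩
  have hsR : Tendsto (fun j => (s j : ℝ)) atTop atTop := tendsto_natCast_atTop_atTop.comp hs
  have hinv : Tendsto (fun j => (1 : ℝ) / s j) atTop (𝓝 0) := tendsto_const_nhds.div_atTop hsR
  have hzero : Tendsto (fun j => E * (1 + t) ^ d * (1 / (s j : ℝ))) atTop (𝓝 0) := by
    simpa using hinv.const_mul (E * (1 + t) ^ d)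
  have hdiff : Tendsto (fun j => colength (I j) / (s j : ℝ) ^ (d + 1) -
      H * ((cnt (valueSemigroup ν) (t * s j) : ℝ) / (s j : ℝ) ^ (d + 1) -
        cnt (valueSet ν (I j)) (t * s j) / (s j : ℝ) ^ (d + 1))) atTop (𝓝 0) := by
    refine squeeze_zero_norm' ?_ hzero
    filter_upwards [hs.eventually_gt_atTop 0] with j hj
    have hj' : (1 : ℝ) ≤ s j := by exact_mod_cast hj
    have hj0 : (0 : ℝ) < s j := by linarith
    have h1 := (hest (I j) (t * s j) (by positivity) (hI j)).2
    have e1 : colength (I j) / (s j : ℝ) ^ (d + 1) -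
      H * ((cnt (valueSemigroup ν) (t * s j) : ℝ) / (s j : ℝ) ^ (d + 1) -
        cnt (valueSet ν (I j)) (t * s j) / (s j : ℝ) ^ (d + 1)) =
      (colength (I j) - H * (cnt (valueSemigroup ν) (t * s j) - cnt (valueSet ν (I j)) (t * s j)))
        / (s j : ℝ) ^ (d + 1) := by ring
    rw [e1, Real.norm_eq_abs, abs_div, abs_of_pos (pow_pos hj0 (d + 1)),
      div_le_iff₀ (pow_pos hj0 (d + 1))]
    refine h1.trans ?_
    have e2 : E * (1 + t) ^ d * (1 / (s j : ℝ)) * (s j : ℝ) ^ (d + 1) =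
        E * ((1 + t) * s j) ^ d := by
      rw [mul_pow, pow_succ]
      field_simp
    rw [e2]
    gcongr
    linarith
  have := hdiff.add ((hL₁.sub hL₂).const_mul H)
  simpa using this

end OKVal

/-! ### Length comparison along a finite local homomorphism. -/

open IsLocalRing in
-- Clearing denominators in a left inverse over the fraction field gives an `A`-linear map from `B`
-- to `A ^ ι` sending `b i` to `x` times the basis vector. Modulo `I` it kills `I B`, and its image
-- contains the multiples of `x`. Equality of residue fields turns `A`-length into `B`-length. Two
-- types `A` and `B` are used so that the module structure through `f`, later the Frobenius, does
-- not clash with that of the ring over itself.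
theorem IsLocalRing.exists_card_mul_length_le {A B : Type*} [CommRing A] [IsDomain A]
    [IsNoetherianRing A] [IsLocalRing A] [CommRing B] [IsLocalRing B] (f : A →+* B)
    (hfin : f.Finite) [IsLocalHom f] (hres : ∀ y, ∃ z, y - f z ∈ maximalIdeal B)
    {ι : Type*} [Fintype ι] (b : ι → B)
    (hb : ∀ c : ι → A, ∑ i, f (c i) * b i = 0 → ∀ i, c i = 0) :
    ∃ x : A, x ≠ 0 ∧ ∀ I : Ideal A, Fintype.card ι * Module.length A (A ⧸ I) ≤
      Module.length B (B ⧸ I.map f) +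
        Fintype.card ι * Module.length A (A ⧸ (I ⊔ Ideal.span {x})) := by
  classical
  let _ : Algebra A B := f.toAlgebra
  have : Module.Finite A B := hfin
  have : IsLocalHom (algebraMap A B) := ‹IsLocalHom f›
  have hli : LinearIndependent A b := Fintype.linearIndependent_iff.2 fun c hc =>
    hb c (by
    simp only [Algebra.smul_def] at hc
    exact hc)
  let K := FractionRing A
  let S := nonZeroDivisors A
  have hli' := LinearIndependent.of_isLocalizedModule K S (LocalizedModule.mkLinearMap S B) hli
  obtain ⟨g, hg⟩ := LinearMap.exists_leftInverse_of_injective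
    (Fintype.linearCombination K (LocalizedModule.mkLinearMap S B ∘ b))
    (LinearMap.ker_eq_bot.2 hli'.fintypeLinearCombination_injective)
  have hgb : ∀ i, g (LocalizedModule.mkLinearMap S B (b i)) = Pi.single i 1 := by
    intro i
    have := LinearMap.congr_fun hg (Pi.single i 1)
    simpa using this
  have : Module.FinitePresentation A B := Module.finitePresentation_of_finite A B
  obtain ⟨ψ, x, hψ⟩ := Module.FinitePresentation.exists_lift_of_isLocalizedModule S
    (LinearMap.pi fun i : ι => Algebra.linearMap A K ∘ₗ LinearMap.proj i)
    ((g.restrictScalars A) ∘ₗ LocalizedModule.mkLinearMap S B)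
  have hψb : ∀ i, ψ (b i) = Pi.single i (x : A) := by
    intro i
    have h1 := LinearMap.congr_fun hψ (b i)
    funext j
    have h2 := congrFun h1 j
    apply IsFractionRing.injective A K
    have h3 : ((x • ((g.restrictScalars A) ∘ₗ LocalizedModule.mkLinearMap S B)) (b i)) j
      = (x : A) • (g (LocalizedModule.mkLinearMap S B (b i)) j) := rfl
    rw [h3, hgb, Pi.single_apply] at h2
    rw [Pi.single_apply]
    refine Eq.trans h2 ?_
    split_ifs <;> simp [Algebra.smul_def, K]
  refine ⟨x, nonZeroDivisors.coe_ne_zero x, fun I => ?_⟩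
  let π : (ι → A ⧸ I) →ₗ[A] (ι → A ⧸ (I ⊔ Ideal.span {(x : A)})) :=
    LinearMap.pi fun i => Submodule.factor le_sup_left ∘ₗ LinearMap.proj i
  have hπ : Function.Surjective π := by
    intro y
    choose z hz using fun i => Submodule.factor_surjective
      (le_sup_left : I ≤ I ⊔ Ideal.span {(x : A)}) (y i)
    exact ⟨z, funext hz⟩
  let θ : B →ₗ[A] (ι → A ⧸ I) := (LinearMap.pi fun i => I.mkQ ∘ₗ LinearMap.proj i) ∘ₗ ψ
  -- A vector in the kernel of `π` has entries congruent to `w i * x` modulo `I`, so it is the image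
  -- of `∑ i, w i • b i`.
  have hker : LinearMap.ker π ≤ LinearMap.range θ := by
    intro y hy
    choose z hz using fun i => I.mkQ_surjective (y i)
    have hmem : ∀ i, z i ∈ I ⊔ Ideal.span {(x : A)} := by
      intro i
      have h1 := congrFun (LinearMap.mem_ker.1 hy) i
      have h2 : Submodule.factor (le_sup_left : I ≤ I ⊔ Ideal.span {(x : A)}) (y i) = 0 := h1
      rw [← hz] at h2
      exact (Submodule.Quotient.mk_eq_zero _).1 h2
    have hmem' : ∀ i, ∃ w, z i - w * x ∈ I := by
      intro i
      obtain ⟨u, hu, v, hv, huv⟩ := Submodule.mem_sup.1 (hmem i)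
      obtain ⟨w, rfl⟩ := Ideal.mem_span_singleton'.1 hv
      exact ⟨w, by rw [← huv, add_sub_cancel_right]; exact hu⟩
    choose w hw using hmem'
    refine ⟨∑ i, w i • b i, ?_⟩
    funext j
    have h1 : ψ (∑ i, w i • b i) j = w j * x := by
      rw [map_sum, Finset.sum_apply, Finset.sum_eq_single j]
      · simp [hψb]
      · intro i _ hij
        simp [hψb, hij.symm]
      · simp
    change I.mkQ (ψ (∑ i, w i • b i) j) = y j
    rw [h1, ← hz j]
    exact ((Submodule.Quotient.eq I).2 (hw j)).symm
  have hlen := Module.length_eq_add_of_exact (LinearMap.ker π).subtype π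
    (Submodule.subtype_injective _) hπ (LinearMap.exact_subtype_ker_map π)
  rw [Module.length_pi, Module.length_pi, ENat.card_eq_coe_fintype_card] at hlen
  rw [hlen]
  gcongr
  refine (Module.length_le_of_injective _ (Submodule.inclusion_injective hker)).trans ?_
  let J : Submodule A B := (I.map f).restrictScalars A
  have hJ : J ≤ LinearMap.ker θ := by
    have hmul : ∀ c ∈ I, ∀ y : B, θ (f c * y) = 0 := by
      intro c hc y
      have h1 : f c * y = c • y := (Algebra.smul_def c y).symm
      rw [h1, map_smul]
      funext i
      obtain ⟨t, ht⟩ := I.mkQ_surjective (θ y i)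
      rw [Pi.smul_apply, ← ht, ← map_smul]
      exact (Submodule.Quotient.mk_eq_zero _).2 (I.mul_mem_right _ hc)
    intro y hy
    have hy' : y ∈ I.map f := hy
    rw [LinearMap.mem_ker]
    refine Submodule.span_induction (p := fun y _ => ∀ z : B, θ (z * y) = 0) ?_ ?_ ?_ ?_ hy' 1 ▸ ?_
    · rintro _ ⟨c, hc, rfl⟩ z
      rw [mul_comm]
      exact hmul c hc z
    · intro z; simp
    · intro y y' _ _ h h' z
      rw [mul_add, map_add, h, h', add_zero]
    · intro r y _ h z
      rw [smul_eq_mul, ← mul_assoc]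
      exact h _
    · rw [one_mul]
  have h1 : Module.length A (LinearMap.range θ) ≤ Module.length A (B ⧸ J) := by
    refine Module.length_le_of_surjective (J.liftQ θ.rangeRestrict ?_) ?_
    · rwa [LinearMap.ker_rangeRestrict]
    · rintro ⟨_, y, rfl⟩
      exact ⟨Submodule.Quotient.mk y, rfl⟩
  have h2 : Module.length A (B ⧸ J) = Module.length A (B ⧸ I.map f) := by
    refine LinearEquiv.length_eq ?_
    exact Submodule.Quotient.restrictScalarsEquiv A (I.map f)
  have h3 : Module.length (ResidueField A) (ResidueField B) ≤ 1 := by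
    have hsurj : Function.Surjective (algebraMap (ResidueField A) (ResidueField B)) := by
      intro y
      obtain ⟨y, rfl⟩ := residue_surjective y
      obtain ⟨z, hz⟩ := hres y
      refine ⟨residue A z, ?_⟩
      rw [← residue_eq_zero_iff, map_sub, sub_eq_zero] at hz
      rw [hz]
      rfl
    rw [← Module.length_eq_one (ResidueField A) (ResidueField A)]
    exact Module.length_le_of_surjective (Algebra.linearMap (ResidueField A) (ResidueField B)) hsurj
  calc _ ≤ Module.length A (B ⧸ I.map f) := h1.trans h2.le
    _ = _ := IsLocalRing.length_restrictScalars A B _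
    _ ≤ Module.length B (B ⧸ I.map f) * 1 := by gcongr
    _ = _ := mul_one _

/-! ### Frobenius powers and multiplication by a fixed element. -/

namespace IdealFamily

variable {R : Type*} [CommRing R]

theorem ne_zero_of_mem_circ [IsDomain R] {c : R} (hc : c ∈ circ R) : c ≠ 0 := by
  rintro rfl
  exact hc ⊥ Ideal.isPrime_bot
    (ringKrullDim_eq_of_ringEquiv (RingEquiv.quotientBot R)) (zero_mem _)

theorem frobeniusPow_le_pow (I : Ideal R) (q : ℕ) : frobeniusPow I q ≤ I ^ q := by
  rw [frobeniusPow, Ideal.span_le]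
  rintro _ ⟨x, hx, rfl⟩
  exact Ideal.pow_mem_pow hx q

theorem frobeniusPow_eq_map (I : Ideal R) (p : ℕ) [ExpChar R p] :
    frobeniusPow I p = I.map (frobenius R p) := rfl

/-- Pigeonhole on a finite generating set: a monomial of high enough degree contains the `q`-th
power of a generator. Hence `μ` depends only on the number of generators. -/
theorem exists_pow_mul_le_frobeniusPow [IsNoetherianRing R] (I : Ideal R) :
    ∃ μ : ℕ, ∀ q : ℕ, I ^ (μ * q) ≤ frobeniusPow I q := by
  classical
  obtain ⟨s, hs⟩ := IsNoetherian.noetherian I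
  have key : ∀ t : Finset R, (t : Set R) ⊆ I → ∀ q,
      Ideal.span (t : Set R) ^ ((t.card + 1) * q) ≤ frobeniusPow I q := by
    intro t
    induction t using Finset.induction_on with
    | empty =>
      intro _ q
      rcases Nat.eq_zero_or_pos q with rfl | hq
      · have : frobeniusPow I 0 = ⊤ :=
          (Ideal.eq_top_iff_one _).2 (Ideal.subset_span ⟨0, I.zero_mem, pow_zero _⟩)
        rw [this]
        exact le_top
      · rw [Finset.coe_empty, Ideal.span_empty, Finset.card_empty, zero_add, one_mul]
        exact (Ideal.pow_le_self hq.ne').trans bot_le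
    | insert x t hx ih =>
      intro ht q
      rw [Finset.coe_insert] at ht ⊢
      rw [Ideal.span_insert, Finset.card_insert_of_notMem hx,
        show (t.card + 1 + 1) * q = q + (t.card + 1) * q by ring]
      refine Ideal.sup_pow_add_le_pow_sup_pow.trans (sup_le ?_ ?_)
      · rw [Ideal.span_singleton_pow, Ideal.span_singleton_le_iff_mem]
        exact Ideal.subset_span ⟨x, ht (Set.mem_insert _ _), rfl⟩
      · exact ih ((Set.subset_insert _ _).trans ht) q
  refine ⟨s.card + 1, fun q => ?_⟩
  have := key s (by rw [← hs]; exact Submodule.subset_span) q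
  rwa [show Ideal.span (s : Set R) = I from hs] at this

end IdealFamily

namespace Ideal

/-- Multiplication by `c` maps `R ⧸ I` to the quotient on the left, with cokernel `R ⧸ (span {c} ⊔
J)`. The ideal `J` serves to keep this cokernel of finite length. -/
theorem length_quotient_mul_sup_le {R : Type*} [CommRing R] (c : R) (I J : Ideal R) :
    Module.length R (R ⧸ (span {c} * I ⊔ J)) ≤
      Module.length R (R ⧸ I) + Module.length R (R ⧸ (span {c} ⊔ J)) := by
  have hle : span {c} * I ⊔ J ≤ span {c} ⊔ J := sup_le_sup_right Ideal.mul_le_left J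
  let θ : (R ⧸ I) →ₗ[R] R ⧸ (span {c} * I ⊔ J) :=
    Submodule.mapQ I _ (LinearMap.mulLeft R c) fun x hx =>
      Ideal.mem_sup_left (Ideal.mul_mem_mul (mem_span_singleton_self c) hx)
  have hker : LinearMap.ker (Submodule.factor hle) ≤ LinearMap.range θ := by
    intro y hy
    obtain ⟨y, rfl⟩ := Submodule.mkQ_surjective _ y
    have hy' : y ∈ span {c} ⊔ J := (Submodule.Quotient.mk_eq_zero _).1 hy
    obtain ⟨u, hu, v, hv, rfl⟩ := Submodule.mem_sup.1 hy'
    obtain ⟨w, rfl⟩ := mem_span_singleton'.1 hu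
    refine ⟨Submodule.Quotient.mk w, (Submodule.Quotient.eq _).2 ?_⟩
    rw [show LinearMap.mulLeft R c w - (w * c + v) = -v by rw [LinearMap.mulLeft_apply]; ring]
    exact neg_mem (Ideal.mem_sup_right hv)
  rw [Module.length_eq_add_of_exact (LinearMap.ker (Submodule.factor hle)).subtype
    (Submodule.factor hle) (Submodule.subtype_injective _) (Submodule.factor_surjective hle)
    (LinearMap.exact_subtype_ker_map _)]
  gcongr
  exact (Module.length_le_of_injective _ (Submodule.inclusion_injective hker)).trans
    (Module.length_le_of_surjective θ.rangeRestrict θ.surjective_rangeRestrict)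

end Ideal

/-! ### The weight filtration against powers of `𝔪`, and the sign of the limit. -/

namespace OKVal

open IdealFamily IsLocalRing

variable {R : Type*} [CommRing R] [IsDomain R] [IsLocalRing R]

section

variable {d : ℕ} {a : Weight d} {ν : FracValuation R a}

theorem IsOK.exists_ideal_le_pow (ok : IsOK ν) : ∃ τ : ℝ, 0 ≤ τ ∧ ∀ n : ℕ,
    ok.dominates.ideal (τ * n) ≤ maximalIdeal R ^ n := by
  obtain ⟨v, hv⟩ := ok.exists_le_pow
  refine ⟨|pairing a v|, abs_nonneg _, fun n r hr => ?_⟩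
  rcases eq_or_ne r 0 with rfl | hr0
  · exact zero_mem _
  refine hv n r ((coe_le_apply_iff (algebraMap_ne_zero hr0)).2 ?_)
  refine le_trans ?_ ((ok.dominates.mem_ideal hr0).1 hr)
  rw [map_nsmul, nsmul_eq_mul, mul_comm]
  exact mul_le_mul_of_nonneg_right (le_abs_self _) n.cast_nonneg

theorem Dominates.ideal_mul_le (h : Dominates ν) (s t : ℝ) :
    h.ideal s * h.ideal t ≤ h.ideal (s + t) := by
  rw [Ideal.mul_le]
  intro x hx y hy
  rcases eq_or_ne x 0 with rfl | hx0
  · simp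
  rcases eq_or_ne y 0 with rfl | hy0
  · simp
  rw [h.mem_ideal (mul_ne_zero hx0 hy0), wt_mul ν hx0 hy0]
  exact add_le_add ((h.mem_ideal hx0).1 hx) ((h.mem_ideal hy0).1 hy)

theorem IsOK.exists_pow_le_ideal (ok : IsOK ν) : ∃ δ : ℝ, 0 < δ ∧ ∀ n : ℕ,
    maximalIdeal R ^ n ≤ ok.dominates.ideal (δ * n) := by
  classical
  -- Only finitely many values of `𝔪` pair below `1`, and all are positive, so the weights on `𝔪`
  -- have a positive lower bound.
  let F : Finset ℝ := insert 1 ((ok.valuesLT (maximalIdeal R) 1).image (pairing a))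
  have hF : F.Nonempty := Finset.insert_nonempty _ _
  have hpos : ∀ x ∈ F, 0 < x := by
    intro x hx
    rcases Finset.mem_insert.1 hx with rfl | hx
    · exact one_pos
    obtain ⟨u, hu, rfl⟩ := Finset.mem_image.1 hx
    obtain ⟨⟨r, hr, hr0, hru⟩, -⟩ := ok.mem_valuesLT.1 hu
    have := (zero_lt_apply_iff (algebraMap_ne_zero hr0)).1 (ok.dominates.pos r hr)
    rwa [val_eq hru] at this
  refine ⟨F.min' hF, hpos _ (F.min'_mem hF), fun n => ?_⟩
  have h1 : maximalIdeal R ≤ ok.dominates.ideal (F.min' hF) := by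
    intro r hr
    rcases eq_or_ne r 0 with rfl | hr0
    · exact zero_mem _
    rw [ok.dominates.mem_ideal hr0]
    rcases lt_or_ge (wt ν r) 1 with h | h
    · exact F.min'_le _ (Finset.mem_insert_of_mem (Finset.mem_image_of_mem _
        (ok.mem_valuesLT.2 ⟨val_mem_valueSet ν hr hr0, h⟩)))
    · exact (F.min'_le 1 (Finset.mem_insert_self _ _)).trans h
  induction n with
  | zero => rw [Nat.cast_zero, mul_zero, ok.dominates.ideal_eq_top le_rfl]; exact le_top
  | succ n ih =>
    rw [pow_succ, Nat.cast_succ, mul_add, mul_one]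
    exact (Ideal.mul_mono ih h1).trans (ok.dominates.ideal_mul_le _ _)

/-- Elements of `R` whose values form a system of representatives of `ℤ^d` modulo `p` are linearly
independent over the subring of `p`-th powers. -/
theorem IsOK.exists_independent_over_frobenius (ok : IsOK ν) (p : ℕ) [Fact p.Prime] :
    ∃ b : (Fin d → Fin p) → R, ∀ c : (Fin d → Fin p) → R,
      ∑ γ, c γ ^ p * b γ = 0 → ∀ γ, c γ = 0 := by
  classical
  have hp := (Fact.out : p.Prime)
  have hS := ok.isPointedSemigroup
  have hex : ∀ γ : Fin d → Fin p, ∃ b : R, b ≠ 0 ∧ ∃ t : WLattice a,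
      val ν (algebraMap R (FractionRing R) b) = natVec a (fun i => γ i) + p • t := by
    intro γ
    -- Write `γ = s - t`. Then `s + (p - 1) • t = γ + p • t` lies in the semigroup and in the class
    -- of `γ` modulo `p`.
    obtain ⟨s, hs, t, ht, hst⟩ := hS.exists_sub_eq (natVec a fun i => (γ i : ℕ))
    obtain ⟨b, hb0, hb⟩ := hS.add_mem s hs _ (hS.nsmul_mem (p - 1) ht)
    refine ⟨b, hb0, t, ?_⟩
    rw [val_eq hb, ← hst]
    rw [add_assoc, ← succ_nsmul', Nat.sub_add_cancel hp.one_lt.le]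
  choose b hb0 t ht using hex
  refine ⟨b, fun c hc => ?_⟩
  by_contra! hne
  obtain ⟨γ₁, hγ₁⟩ := hne
  let T := Finset.univ.filter fun γ => c γ ≠ 0
  have hterm : ∀ γ ∈ T, c γ ^ p * b γ ≠ 0 := fun γ hγ =>
    mul_ne_zero (pow_ne_zero _ (Finset.mem_filter.1 hγ).2) (hb0 γ)
  have hval : ∀ γ ∈ T, ∃ w : WLattice a,
      val ν (algebraMap R (FractionRing R) (c γ ^ p * b γ)) =
        natVec a (fun i => γ i) + p • w := by
    intro γ hγ
    have h0 := (Finset.mem_filter.1 hγ).2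
    have hpow : ∀ n : ℕ, val ν (algebraMap R (FractionRing R) (c γ ^ n)) =
        n • val ν (algebraMap R (FractionRing R) (c γ)) := by
      intro n
      induction n with
      | zero =>
        rw [pow_zero, map_one, zero_smul]
        exact val_eq (AddValuation.map_one ν)
      | succ n ih =>
        rw [pow_succ, map_mul, val_mul ν (algebraMap_ne_zero (pow_ne_zero _ h0))
          (algebraMap_ne_zero h0), ih, succ_nsmul]
    refine ⟨val ν (algebraMap R (FractionRing R) (c γ)) + t γ, ?_⟩
    rw [map_mul, val_mul ν (algebraMap_ne_zero (pow_ne_zero _ h0)) (algebraMap_ne_zero (hb0 γ)),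
      hpow, ht, smul_add]
    abel
  -- A `p`-th power has value divisible by `p`, so nonzero terms lie in distinct classes. The term
  -- of least value then cannot be cancelled by the others.
  have hinj : ∀ γ ∈ T, ∀ γ' ∈ T, wt ν (c γ ^ p * b γ) = wt ν (c γ' ^ p * b γ') → γ = γ' := by
    intro γ hγ γ' hγ' h
    obtain ⟨w, hw⟩ := hval γ hγ
    obtain ⟨w', hw'⟩ := hval γ' hγ'
    have h1 := pairing_injective a h
    rw [hw, hw'] at h1
    funext i
    have h2 := congrFun (show (natVec a (fun i => (γ i : ℕ)) + p • w : Fin d → ℤ) = _ from h1) i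
    rw [coe_add, coe_add, coe_nsmul, coe_nsmul] at h2
    have h3 : ((γ i : ℕ) : ℤ) + p * (w : Fin d → ℤ) i = ((γ' i : ℕ) : ℤ) + p * (w' : Fin d → ℤ) i :=
      h2
    have h4 := congrArg (· % (p : ℤ)) h3
    simp only [Int.add_mul_emod_self_left] at h4
    rw [Int.emod_eq_of_lt (by positivity) (by exact_mod_cast (γ i).2),
      Int.emod_eq_of_lt (by positivity) (by exact_mod_cast (γ' i).2)] at h4
    exact Fin.ext (by exact_mod_cast h4)
  obtain ⟨γ₀, hγ₀, hmin⟩ := Finset.exists_min_image T (fun γ => wt ν (c γ ^ p * b γ))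
    ⟨γ₁, Finset.mem_filter.2 ⟨Finset.mem_univ _, hγ₁⟩⟩
  have hsum : ∑ γ ∈ T.erase γ₀, algebraMap R (FractionRing R) (c γ ^ p * b γ) =
      -algebraMap R (FractionRing R) (c γ₀ ^ p * b γ₀) := by
    rw [eq_neg_iff_add_eq_zero, Finset.sum_erase_add _ _ hγ₀, ← map_sum, Finset.sum_filter_of_ne,
      hc, map_zero]
    intro γ _ h h0
    rw [h0, zero_pow hp.ne_zero, zero_mul] at h
    exact h rfl
  have hlt := AddValuation.map_lt_sum ν (s := T.erase γ₀)
    (f := fun γ => algebraMap R (FractionRing R) (c γ ^ p * b γ))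
    (g := ν (algebraMap R (FractionRing R) (c γ₀ ^ p * b γ₀)))
    ((AddValuation.ne_top_iff ν).2 (algebraMap_ne_zero (hterm γ₀ hγ₀))) (by
      intro γ hγ
      obtain ⟨hne, hγT⟩ := Finset.mem_erase.1 hγ
      rw [← not_le, ← coe_val ν (algebraMap_ne_zero (hterm γ hγT)),
        ← coe_val ν (algebraMap_ne_zero (hterm γ₀ hγ₀)), WithTop.coe_le_coe, le_iff]
      intro hle
      exact hne (hinj γ hγT γ₀ hγ₀ (le_antisymm hle (hmin γ hγT))))
  rw [hsum, AddValuation.map_neg] at hlt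
  exact lt_irrefl _ hlt

end

section

variable {d : ℕ} {a : Weight (d + 1)} {ν : FracValuation R a}

theorem IsOK.maximalIdeal_ne_bot (ok : IsOK ν) : maximalIdeal R ≠ ⊥ := by
  intro h
  have h1 := ringKrullDim_eq_zero_of_isField (isField_iff_maximalIdeal_eq.2 h)
  rw [ok.dim_eq] at h1
  exact absurd (by exact_mod_cast h1 : d + 1 = 0) (by omega)

theorem IsOK.valueSet_nonempty (ok : IsOK ν) {M : Ideal R} {n : ℕ}
    (h : maximalIdeal R ^ n ≤ M) : (valueSet ν M).Nonempty := by
  have hM : M ≠ ⊥ := fun h0 => pow_ne_zero n ok.maximalIdeal_ne_bot (le_bot_iff.1 (h0 ▸ h))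
  obtain ⟨r, hr, hr0⟩ := Submodule.exists_mem_ne_zero_of_ne_bot hM
  exact ⟨_, val_mem_valueSet ν hr hr0⟩

theorem IsOK.exists_colength_le (ok : IsOK ν) : ∃ K : ℝ, 0 ≤ K ∧ ∀ (M : Ideal R) (t : ℝ), 0 ≤ t →
    ok.dominates.ideal t ≤ M → colength M ≤ K * (1 + t) ^ (d + 1) := by
  obtain ⟨H, E, hH, hE, hest⟩ := ok.exists_colength_estimate
  obtain ⟨K, hK, hcnt⟩ := ok.isPointedSemigroup.exists_cnt_le
  refine ⟨H * K + E, by positivity, fun M t ht hM => ?_⟩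
  have h1 := (abs_le.1 (hest M t ht hM).2).2
  have h2 := mul_le_mul_of_nonneg_left (hcnt _ subset_rfl t ht) hH.le
  have h3 : 0 ≤ H * (cnt (valueSet ν M) t : ℝ) := by positivity
  have h4 : E * (1 + t) ^ d ≤ E * (1 + t) ^ (d + 1) :=
    mul_le_mul_of_nonneg_left (pow_le_pow_right₀ (by linarith) (Nat.le_succ d)) hE
  nlinarith

theorem IsOK.exists_le_colength_ideal (ok : IsOK ν) : ∃ ε : ℝ, 0 < ε ∧ ∃ x₀ : ℝ, ∀ t, x₀ ≤ t →
    ε * t ^ (d + 1) ≤ colength (ok.dominates.ideal t) := by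
  obtain ⟨H, E, hH, hE, hest⟩ := ok.exists_colength_estimate
  obtain ⟨ε, hε, x₀, hcnt⟩ := ok.isPointedSemigroup.exists_le_cnt
  -- Beyond this threshold `1 + t ≤ 2 * t`, and the error `E * (1 + t) ^ d` is at most half of the
  -- main term.
  refine ⟨H * ε / 2, by positivity, max x₀ (max 1 (E * 2 ^ d / (H * ε / 2))), fun t ht => ?_⟩
  have ht0 := (le_max_left _ _).trans ht
  have ht1 : 1 ≤ t := (le_max_left _ _).trans ((le_max_right _ _).trans ht)
  have ht2 : E * 2 ^ d / (H * ε / 2) ≤ t :=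
    (le_max_right _ _).trans ((le_max_right _ _).trans ht)
  rw [div_le_iff₀ (by positivity)] at ht2
  have h1 := (abs_le.1 (hest (ok.dominates.ideal t) t (by linarith) le_rfl).2).1
  have h2 : cnt (valueSet ν (ok.dominates.ideal t)) t = 0 := by
    rw [← ok.card_valuesLT, Finset.card_eq_zero, Finset.eq_empty_iff_forall_notMem]
    intro u hu
    obtain ⟨⟨r, hr, hr0, hru⟩, hut⟩ := ok.mem_valuesLT.1 hu
    have := (ok.dominates.mem_ideal hr0).1 hr
    rw [wt, val_eq hru] at this
    linarith
  rw [h2, Nat.cast_zero, sub_zero] at h1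
  have h3 := mul_le_mul_of_nonneg_left (hcnt t ht0) hH.le
  have h4 : E * (1 + t) ^ d ≤ E * (2 * t) ^ d := by gcongr; linarith
  have h5 : E * (2 * t) ^ d ≤ (H * ε / 2) * t ^ (d + 1) := by
    calc E * (2 * t) ^ d = (E * 2 ^ d) * t ^ d := by rw [mul_pow]; ring
      _ ≤ (t * (H * ε / 2)) * t ^ d := by gcongr
      _ = _ := by ring
  nlinarith

theorem IsOK.lim_pos (ok : IsOK ν) {s : ℕ → ℕ} (hs : Tendsto s atTop atTop) {I : ℕ → Ideal R}
    {L : ℝ} (hL : Tendsto (fun j => colength (I j) / (s j : ℝ) ^ (d + 1)) atTop (𝓝 L))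
    (hfin : ∀ j, Module.length R (R ⧸ I j) ≠ ⊤) {δ : ℝ} (hδ : 0 < δ)
    (hI : ∀ᶠ j in atTop, I j ≤ ok.dominates.ideal (δ * s j)) : 0 < L := by
  obtain ⟨ε, hε, x₀, hx₀⟩ := ok.exists_le_colength_ideal
  refine lt_of_lt_of_le (show 0 < ε * δ ^ (d + 1) by positivity) (ge_of_tendsto hL ?_)
  have hsR : Tendsto (fun j => δ * (s j : ℝ)) atTop atTop :=
    (tendsto_natCast_atTop_atTop.comp hs).const_mul_atTop hδ
  filter_upwards [hI, hsR.eventually_ge_atTop x₀, hs.eventually_gt_atTop 0] with j hj hj1 hj0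
  have hj0' : (0 : ℝ) < s j := by exact_mod_cast hj0
  rw [le_div_iff₀ (by positivity), mul_assoc, ← mul_pow]
  exact (hx₀ _ hj1).trans (colength_anti hj (hfin j))

/-- Along a subsequence, `I_j` contains a nonzero element of weight `O(s j / i)` with `i` tending to
infinity; `exists_colength_sup_le` then gives normalized colength `O(1 / i)`. -/
theorem IsOK.lim_nonpos (ok : IsOK ν) {s : ℕ → ℕ} {I : ℕ → Ideal R}
    {L : ℝ} (hL : Tendsto (fun j => colength (I j) / (s j : ℝ) ^ (d + 1)) atTop (𝓝 L))
    {t : ℝ} (ht : 0 ≤ t) (hI : ∀ j, ok.dominates.ideal (t * s j) ≤ I j) {C : ℝ}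
    (h : ∀ i : ℕ, 0 < i → ∃ j, i ≤ j ∧ i ≤ s j ∧ ∃ f ∈ I j, f ≠ 0 ∧ wt ν f ≤ C * s j / i) :
    L ≤ 0 := by
  obtain ⟨K, hK, hsup⟩ := ok.exists_colength_sup_le
  choose φ hφ hsφ f hf hf0 hw using fun i : ℕ => h (i + 1) i.succ_pos
  have hφ' : Tendsto φ atTop atTop :=
    tendsto_atTop_mono (fun i => (Nat.le_succ i).trans (hφ i)) tendsto_id
  have hlim : Tendsto (fun i : ℕ => (K * (1 + |C|) * (1 + t) ^ d) * (1 / ((i : ℝ) + 1))) atTop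
      (𝓝 0) := by
    simpa using tendsto_one_div_add_atTop_nhds_zero_nat.const_mul (K * (1 + |C|) * (1 + t) ^ d)
  refine le_of_tendsto_of_tendsto (hL.comp hφ') hlim (Eventually.of_forall fun i => ?_)
  have hs1 : (i : ℝ) + 1 ≤ s (φ i) := by exact_mod_cast hsφ i
  have hi0 : (0 : ℝ) < (i : ℝ) + 1 := by positivity
  have hs0 : (0 : ℝ) < s (φ i) := by linarith
  have hs2 : (1 : ℝ) ≤ s (φ i) := le_trans (by linarith [(Nat.cast_nonneg i : (0 : ℝ) ≤ i)]) hs1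
  -- The requirement `i ≤ s j` is what absorbs the summand `1`.
  have hw' : 1 + wt ν (f i) ≤ (1 + |C|) * (1 / ((i : ℝ) + 1)) * s (φ i) := by
    have h1 := hw i
    push_cast at h1
    have h2 : 1 ≤ s (φ i) / ((i : ℝ) + 1) := by rwa [le_div_iff₀ hi0, one_mul]
    have h3 : C * s (φ i) / ((i : ℝ) + 1) ≤ |C| * (s (φ i) / ((i : ℝ) + 1)) := by
      rw [mul_div_assoc]
      exact mul_le_mul_of_nonneg_right (le_abs_self C) (by positivity)
    have h4 : (1 + |C|) * (1 / ((i : ℝ) + 1)) * s (φ i) =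
      s (φ i) / ((i : ℝ) + 1) + |C| * (s (φ i) / ((i : ℝ) + 1)) := by ring
    linarith
  simp only [Function.comp]
  rw [div_le_iff₀ (by positivity)]
  calc colength (I (φ i)) ≤ K * (1 + wt ν (f i)) * (1 + t * s (φ i)) ^ d :=
        hsup _ _ _ (hf0 i) (hf i) (by positivity) (hI _)
    _ ≤ K * ((1 + |C|) * (1 / ((i : ℝ) + 1)) * s (φ i)) * ((1 + t) * s (φ i)) ^ d := by
        gcongr
        linarith
    _ = _ := by rw [mul_pow]; ring

end

end OKVal

/-! ### Limits for the three kinds of families, and the BAL criteria. -/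

namespace OKVal

open IdealFamily IsLocalRing

variable {R : Type*} [CommRing R] [IsDomain R] [IsLocalRing R]
  {d : ℕ} {a : Weight (d + 1)} {ν : FracValuation R a}

/-- Divide `j` by `m`: multiplying `j / m` copies of an element of `I m` into a fixed element of `I
(j % m)` costs one factor `c` per step, so the translation is linear in `j / m`. -/
theorem IsOK.exists_tendsto_colength_graded (ok : IsOK ν) {I : ℕ → Ideal R}
    (hB : IsBBL I) (hI : IsWeaklyGraded I) {t : ℝ} (ht : 0 ≤ t)
    (htI : ∀ n : ℕ, ok.dominates.ideal (t * n) ≤ I n) :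
    ∃ L : ℝ, Tendsto (fun n : ℕ => colength (I n) / (n : ℝ) ^ (d + 1)) atTop (𝓝 L) := by
  obtain ⟨b, hb⟩ := hB
  obtain ⟨c, hc, hI⟩ := hI
  have hc0 := ne_zero_of_mem_circ hc
  set u₀ := val ν (algebraMap R (FractionRing R) c) with hu₀
  have hadd : ∀ m n, ∀ u ∈ valueSet ν (I m), ∀ v ∈ valueSet ν (I n),
      u₀ + (u + v) ∈ valueSet ν (I (m + n)) := fun m n u hu v hv =>
    valueSet_add_mem (hI m n)
      (val_mem_valueSet ν (Ideal.mem_span_singleton_self c) hc0) (valueSet_add_mem le_rfl hu hv)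
  choose z hz using fun n => ok.valueSet_nonempty (hb n)
  refine ok.exists_tendsto_colength (s := fun n => n) tendsto_id I ht htI (pairing a u₀)
    fun m hm => ?_
  -- The remainder takes only `m` values, so the weights of the chosen `z (j % m)` are bounded
  -- independently of `j`.
  obtain ⟨C, hC⟩ := ((Finset.range m).image fun r => pairing a (z r)).exists_le
  refine ⟨C, Eventually.of_forall fun j => ⟨(j / m) • u₀ + z (j % m), ?_, fun u hu => ?_⟩⟩
  · rw [map_add, map_nsmul, nsmul_eq_mul, add_comm, mul_comm]
    gcongr
    exact hC _ (Finset.mem_image_of_mem _ (Finset.mem_range.2 (Nat.mod_lt j hm)))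
  · have key : ∀ n, n • u + (n • u₀ + z (j % m)) ∈ valueSet ν (I (m * n + j % m)) := by
      intro n
      induction n with
      | zero => simpa using hz (j % m)
      | succ n ih =>
        have h1 := hadd m _ u hu _ ih
        rw [show m * (n + 1) + j % m = m + (m * n + j % m) by ring,
          show (n + 1) • u + ((n + 1) • u₀ + z (j % m)) =
            u₀ + (u + (n • u + (n • u₀ + z (j % m)))) by rw [succ_nsmul, succ_nsmul]; abel]
        exact h1
    have := key (j / m)
    rwa [Nat.div_add_mod] at this

theorem IsOK.exists_tendsto_colength_pFamily (ok : IsOK ν) {p : ℕ} (hp : p.Prime)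
    {I : ℕ → Ideal R} (hI : IsWeaklyPFamily p I) {t : ℝ} (ht : 0 ≤ t)
    (htI : ∀ e : ℕ, ok.dominates.ideal (t * (p ^ e : ℕ)) ≤ I e) :
    ∃ L : ℝ, Tendsto (fun e : ℕ => colength (I e) / ((p ^ e : ℕ) : ℝ) ^ (d + 1)) atTop (𝓝 L) := by
  obtain ⟨c, hc, hI⟩ := hI
  have hc0 := ne_zero_of_mem_circ hc
  set u₀ := val ν (algebraMap R (FractionRing R) c) with hu₀
  have hu₀0 : 0 ≤ pairing a u₀ := ok.dominates.wt_nonneg hc0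
  have hfrob : ∀ e, ∀ u ∈ valueSet ν (I e), u₀ + p • u ∈ valueSet ν (I (e + 1)) := by
    rintro e u ⟨r, hr, hr0, hru⟩
    refine valueSet_add_mem (hI e) (val_mem_valueSet ν (Ideal.mem_span_singleton_self c) hc0)
      ⟨r ^ p, Ideal.subset_span ⟨r, hr, rfl⟩, pow_ne_zero _ hr0, ?_⟩
    rw [map_pow, AddValuation.map_pow, hru]
    rfl
  refine ok.exists_tendsto_colength (s := fun e => p ^ e)
    (tendsto_pow_atTop_atTop_of_one_lt hp.one_lt) I ht htI (pairing a u₀) fun i _ => ?_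
  have key : ∀ g : ℕ, ∃ k < p ^ g, ∀ u ∈ valueSet ν (I i),
      p ^ g • u + k • u₀ ∈ valueSet ν (I (i + g)) := by
    intro g
    induction g with
    | zero => exact ⟨0, by simp, fun u hu => by simpa using hu⟩
    | succ g ih =>
      obtain ⟨k, hk, h⟩ := ih
      -- Frobenius multiplies the accumulated power `k` of `c` by `p`, and the weak inclusion adds
      -- one more. The total stays below `p ^ g`, hence linear in the index ratio.
      refine ⟨p * k + 1, ?_, fun u hu => ?_⟩
      · have h1 : p * (k + 1) ≤ p * p ^ g := Nat.mul_le_mul_left p hk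
        have h2 := hp.two_le
        rw [pow_succ']
        nlinarith
      · have h1 := hfrob _ _ (h u hu)
        rw [show p ^ (g + 1) • u + (p * k + 1) • u₀ = u₀ + p • (p ^ g • u + k • u₀) by
          rw [smul_add, succ_nsmul, pow_succ', mul_smul, mul_smul]; abel]
        exact h1
  refine ⟨0, ?_⟩
  filter_upwards [eventually_ge_atTop i] with j hj
  obtain ⟨g, rfl⟩ := Nat.exists_eq_add_of_le hj
  obtain ⟨k, hk, h⟩ := key g
  have hdiv : p ^ (i + g) / p ^ i = p ^ g := by
    rw [pow_add, Nat.mul_div_cancel_left _ (pow_pos hp.pos i)]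
  rw [hdiv]
  refine ⟨k • u₀, ?_, h⟩
  rw [map_nsmul, nsmul_eq_mul, zero_add, mul_comm]
  gcongr

theorem exists_sub_frobenius_mem (p : ℕ) [Fact p.Prime] [CharP R p]
    [PerfectField (ResidueField R)] (y : R) : ∃ z, y - frobenius R p z ∈ maximalIdeal R := by
  have : CharP (ResidueField R) p :=
    CharP.of_ringHom_of_ne_zero (residue R) p (Fact.out : p.Prime).ne_zero
  obtain ⟨z, hz⟩ := surjective_frobenius (ResidueField R) p (residue R y)
  obtain ⟨z, rfl⟩ := residue_surjective z
  refine ⟨z, ?_⟩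
  rw [← residue_eq_zero_iff, map_sub, sub_eq_zero, ← hz, frobenius_def, frobenius_def, map_pow]

/-- The length comparison along Frobenius relates `I_q` to `I_q^{[p]}`, which contains `c I_{pq}`.
The errors are colengths of ideals containing the fixed nonzero `c` or `x`, hence `O(q ^ d)`. -/
theorem IsOK.exists_pow_mul_colength_le [IsNoetherianRing R] (ok : IsOK ν) {p : ℕ} [Fact p.Prime] [CharP R p]
    (hfin : (frobenius R p).Finite) [PerfectField (ResidueField R)]
    {I : ℕ → Ideal R} (hB : IsBBLPow p I) (hI : IsWeaklyInversePFamily p I) {t : ℝ} (ht : 0 ≤ t)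
    (htI : ∀ e : ℕ, ok.dominates.ideal (t * (p ^ e : ℕ)) ≤ I e) :
    ∃ K : ℝ, 0 ≤ K ∧ ∀ e, (p : ℝ) ^ (d + 1) * colength (I e) ≤
      colength (I (e + 1)) + K * ((p ^ e : ℕ) : ℝ) ^ d := by
  have hp := (Fact.out : p.Prime)
  obtain ⟨b, hb⟩ := hB
  obtain ⟨c, hc, hI⟩ := hI
  have hc0 := ne_zero_of_mem_circ hc
  obtain ⟨y, hy⟩ := ok.exists_independent_over_frobenius p
  have : IsLocalHom (frobenius R p) := ⟨fun r hr => by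
    rw [frobenius_def] at hr
    exact (isUnit_pow_iff hp.ne_zero).1 hr⟩
  obtain ⟨x, hx0, hx⟩ := IsLocalRing.exists_card_mul_length_le (frobenius R p) hfin
    (exists_sub_frobenius_mem p) y hy
  have hcard : Fintype.card (Fin (d + 1) → Fin p) = p ^ (d + 1) := by simp
  rw [hcard] at hx
  obtain ⟨K, hK, hsup⟩ := ok.exists_colength_sup_le
  obtain ⟨τ, hτ, hideal⟩ := ok.exists_ideal_le_pow
  obtain ⟨μ, hμ⟩ := exists_pow_mul_le_frobeniusPow (maximalIdeal R)
  -- Chosen so that weight at least `t₁ * q` forces membership in `𝔪 ^ (μ * p * (b * q))`, hence in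
  -- `(𝔪 ^ (b * q))^{[p]}` and in `I_q^{[p]}`.
  set t₁ := τ * (μ * p * b) with ht₁
  have ht₁0 : 0 ≤ t₁ := by positivity
  have hwc := ok.dominates.wt_nonneg hc0
  have hwx := ok.dominates.wt_nonneg hx0
  refine ⟨K * (1 + wt ν c) * (1 + t₁) ^ d + p ^ (d + 1) * (K * (1 + wt ν x) * (1 + t) ^ d),
    by positivity, fun e => ?_⟩
  set q : ℕ := p ^ e with hq
  have hq1 : (1 : ℝ) ≤ q := by
    have : 1 ≤ q := Nat.one_le_pow _ _ hp.pos
    exact_mod_cast this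
  set J := ok.dominates.ideal (t₁ * q) with hJ
  have hJle : J ≤ (I e).map (frobenius R p) := by
    have h1 : J ≤ maximalIdeal R ^ (μ * p * b * q) := by
      refine le_trans (le_of_eq ?_) (hideal _)
      rw [hJ, ht₁]
      push_cast
      ring_nf
    refine h1.trans ?_
    rw [show μ * p * b * q = (μ * p) * (b * q) by ring, pow_mul]
    refine (Ideal.pow_right_mono (hμ p) _).trans ?_
    rw [frobeniusPow_eq_map, ← Ideal.map_pow]
    exact Ideal.map_mono (hb e)
  have hle : Ideal.span {c} * I (e + 1) ⊔ J ≤ (I e).map (frobenius R p) :=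
    sup_le (hI e) hJle
  have h1 : Module.length R (R ⧸ (I e).map (frobenius R p)) ≤
      Module.length R (R ⧸ I (e + 1)) + Module.length R (R ⧸ (Ideal.span {c} ⊔ J)) :=
    (Module.length_le_of_surjective (Submodule.factor hle) (Submodule.factor_surjective hle)).trans
      (Ideal.length_quotient_mul_sup_le c _ J)
  have h2 := (hx (I e)).trans (add_le_add_left h1 _)
  have f1 := ok.length_ne_top (htI e)
  have f2 := ok.length_ne_top (htI (e + 1))
  have f3 := ok.length_ne_top (M := Ideal.span {c} ⊔ J) le_sup_right
  have f4 := ok.length_ne_top (M := I e ⊔ Ideal.span {x}) ((htI e).trans le_sup_left)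
  have g3 := hsup (Ideal.span {c} ⊔ J) c (t₁ * q) hc0
    (Ideal.mem_sup_left (Ideal.mem_span_singleton_self c)) (by positivity) le_sup_right
  have g4 := hsup (I e ⊔ Ideal.span {x}) x (t * q) hx0
    (Ideal.mem_sup_right (Ideal.mem_span_singleton_self x)) (by positivity)
    ((htI e).trans le_sup_left)
  have hscale : ∀ s : ℝ, 0 ≤ s → (1 + s * q) ^ d ≤ (1 + s) ^ d * (q : ℝ) ^ d := by
    intro s hs
    rw [← mul_pow]
    gcongr
    linarith
  have g3' : colength (Ideal.span {c} ⊔ J) ≤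
      K * (1 + wt ν c) * ((1 + t₁) ^ d * (q : ℝ) ^ d) :=
    g3.trans (mul_le_mul_of_nonneg_left (hscale _ ht₁0) (by positivity))
  have g4' : colength (I e ⊔ Ideal.span {x}) ≤
      K * (1 + wt ν x) * ((1 + t) ^ d * (q : ℝ) ^ d) :=
    g4.trans (mul_le_mul_of_nonneg_left (hscale _ ht) (by positivity))
  have h3 : (p : ℝ) ^ (d + 1) * colength (I e) ≤ colength (I (e + 1)) +
      colength (Ideal.span {c} ⊔ J) + p ^ (d + 1) * colength (I e ⊔ Ideal.span {x}) := by
    rw [colength, colength, colength, colength]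
    rw [← ENat.natCast_toNat f1, ← ENat.natCast_toNat f2, ← ENat.natCast_toNat f3,
      ← ENat.natCast_toNat f4] at h2
    exact_mod_cast h2
  have g5 := mul_le_mul_of_nonneg_left g4' (show (0 : ℝ) ≤ (p : ℝ) ^ (d + 1) by positivity)
  linarith

theorem IsOK.exists_tendsto_colength_inversePFamily [IsNoetherianRing R] (ok : IsOK ν) {p : ℕ}
    [Fact p.Prime] [CharP R p] (hfin : (frobenius R p).Finite) [PerfectField (ResidueField R)]
    {I : ℕ → Ideal R} (hB : IsBBLPow p I) (hI : IsWeaklyInversePFamily p I) {t : ℝ} (ht : 0 ≤ t)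
    (htI : ∀ e : ℕ, ok.dominates.ideal (t * (p ^ e : ℕ)) ≤ I e) :
    ∃ L : ℝ, Tendsto (fun e : ℕ => colength (I e) / ((p ^ e : ℕ) : ℝ) ^ (d + 1)) atTop (𝓝 L) := by
  have hp := (Fact.out : p.Prime)
  obtain ⟨K, hK, hstep⟩ := ok.exists_pow_mul_colength_le hfin hB hI ht htI
  obtain ⟨K', hK', hbound⟩ := ok.exists_colength_le
  set x : ℕ → ℝ := fun e => colength (I e) / ((p ^ e : ℕ) : ℝ) ^ (d + 1) with hx
  have hp2 : (2 : ℝ) ≤ p := by exact_mod_cast hp.two_le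
  have hpos : ∀ e : ℕ, (1 : ℝ) ≤ ((p ^ e : ℕ) : ℝ) := fun e => by
    have : 1 ≤ p ^ e := Nat.one_le_pow _ _ hp.pos
    exact_mod_cast this
  -- One step loses at most `K / q`, while the correction `2 * K / q` drops by at least `K / q` when
  -- `q` becomes `p * q`, as `p ≥ 2`.
  have hmono : Monotone fun e => x e - 2 * K / ((p ^ e : ℕ) : ℝ) := by
    refine monotone_nat_of_le_succ fun e => ?_
    have hq := hpos e
    have h1 : x e ≤ x (e + 1) + K / (((p ^ e : ℕ) : ℝ)) / p ^ (d + 1) := by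
      have h2 := hstep e
      have e1 : x (e + 1) = colength (I (e + 1)) / (p ^ (d + 1) * ((p ^ e : ℕ) : ℝ) ^ (d + 1)) := by
        simp only [hx]
        push_cast
        rw [← mul_pow, pow_succ' (p : ℝ) e]
      have e2 : K / (((p ^ e : ℕ) : ℝ)) / p ^ (d + 1) =
          K * ((p ^ e : ℕ) : ℝ) ^ d / (p ^ (d + 1) * ((p ^ e : ℕ) : ℝ) ^ (d + 1)) := by
        rw [pow_succ ((p ^ e : ℕ) : ℝ) d]
        field_simp
      have e3 : x e = p ^ (d + 1) * colength (I e) /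
          (p ^ (d + 1) * ((p ^ e : ℕ) : ℝ) ^ (d + 1)) := by
        rw [mul_div_mul_left _ _ (by positivity)]
      rw [e1, e2, e3, ← add_div]
      gcongr
    have h3 : K / ((p ^ e : ℕ) : ℝ) / p ^ (d + 1) ≤ K / ((p ^ e : ℕ) : ℝ) := by
      refine div_le_self (by positivity) (one_le_pow₀ (by linarith))
    have h4 : 2 * K / ((p ^ (e + 1) : ℕ) : ℝ) ≤ K / ((p ^ e : ℕ) : ℝ) := by
      rw [div_le_div_iff₀ (by linarith [hpos (e + 1)]) (by linarith), pow_succ, Nat.cast_mul]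
      have : 0 ≤ K * ((p ^ e : ℕ) : ℝ) := by positivity
      nlinarith
    have h5 : 2 * K / ((p ^ e : ℕ) : ℝ) = K / ((p ^ e : ℕ) : ℝ) + K / ((p ^ e : ℕ) : ℝ) := by ring
    rw [h5]
    linarith
  have hlim : Tendsto (fun e : ℕ => 2 * K / ((p ^ e : ℕ) : ℝ)) atTop (𝓝 0) :=
    tendsto_const_nhds.div_atTop
      (tendsto_natCast_atTop_atTop.comp (tendsto_pow_atTop_atTop_of_one_lt hp.one_lt))
  have hbdd : BddAbove (Set.range fun e => x e - 2 * K / ((p ^ e : ℕ) : ℝ)) := by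
    refine ⟨K' * (1 + t) ^ (d + 1), ?_⟩
    rintro _ ⟨e, rfl⟩
    have hq := hpos e
    have h1 : x e ≤ K' * (1 + t) ^ (d + 1) := by
      rw [hx]
      dsimp only
      rw [div_le_iff₀ (by positivity), mul_assoc, ← mul_pow]
      refine (hbound _ _ (by positivity) (htI e)).trans ?_
      gcongr
      linarith
    have h2 : 0 ≤ 2 * K / ((p ^ e : ℕ) : ℝ) := by positivity
    dsimp only
    linarith
  have := (tendsto_atTop_ciSup hmono hbdd).add hlim
  simp only [sub_add_cancel] at this
  exact ⟨_, this⟩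

theorem IsOK.isBAL_iff (ok : IsOK ν) {I : ℕ → Ideal R} {t : ℝ} (ht : 0 ≤ t)
    (htI : ∀ n : ℕ, ok.dominates.ideal (t * n) ≤ I n) {L : ℝ}
    (hL : Tendsto (fun n : ℕ => colength (I n) / (n : ℝ) ^ (d + 1)) atTop (𝓝 L)) :
    IsBAL I ↔ 0 < L := by
  constructor
  · rintro ⟨c, hc, hI⟩
    obtain ⟨δ, hδ, hpow⟩ := ok.exists_pow_le_ideal
    have hc' : (0 : ℝ) < c := by exact_mod_cast hc
    refine ok.lim_pos (s := fun n => n) tendsto_id hL (fun n => ok.length_ne_top (htI n))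
      -- For `n ≥ c` the integer quotient `n / c` is at least `n / (2 * c)`.
      (δ := δ / (2 * c)) (by positivity) ?_
    filter_upwards [eventually_ge_atTop c] with n hn
    refine (hI n).trans ((hpow _).trans (ok.dominates.ideal_anti ?_))
    have h1 : n < 2 * c * (n / c) := by
      have h2 := Nat.div_add_mod n c
      have h3 := Nat.mod_lt n hc
      have h4 : 1 ≤ n / c := (Nat.one_le_div_iff hc).2 hn
      nlinarith
    have h2 : (n : ℝ) ≤ 2 * c * (n / c : ℕ) := by exact_mod_cast h1.le
    rw [div_mul_eq_mul_div, div_le_iff₀ (by positivity)]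
    nlinarith
  · intro hpos
    by_contra hBAL
    obtain ⟨τ, hτ, hideal⟩ := ok.exists_ideal_le_pow
    refine absurd (ok.lim_nonpos (s := fun n => n) hL ht htI (C := τ) fun i hi => ?_)
      (not_le.2 hpos)
    by_contra hcon
    -- If no light element exists for `i`, then `i` itself is a BAL constant: for `n < i` the
    -- exponent is `0`, and otherwise a counterexample `f` would weigh less than `τ * (n / i)`.
    refine hBAL ⟨i, hi, fun n f hf => ?_⟩
    rcases lt_or_ge n i with hn | hn
    · rw [Nat.div_eq_of_lt hn, pow_zero, Ideal.one_eq_top]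
      trivial
    rcases eq_or_ne f 0 with rfl | hf0
    · exact zero_mem _
    refine hideal _ ((ok.dominates.mem_ideal hf0).2 ?_)
    by_contra hlt
    refine hcon ⟨n, hn, hn, f, hf, hf0, (not_le.1 hlt).le.trans ?_⟩
    rw [mul_div_assoc]
    exact mul_le_mul_of_nonneg_left Nat.cast_div_le hτ

theorem IsOK.isBALPow_iff [IsNoetherianRing R] (ok : IsOK ν) {p : ℕ} (hp : p.Prime)
    {I : ℕ → Ideal R} {t : ℝ} (ht : 0 ≤ t) (htI : ∀ e : ℕ, ok.dominates.ideal (t * (p ^ e : ℕ)) ≤ I e) {L : ℝ}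
    (hL : Tendsto (fun e : ℕ => colength (I e) / ((p ^ e : ℕ) : ℝ) ^ (d + 1)) atTop (𝓝 L)) :
    IsBALPow p I ↔ 0 < L := by
  have hs : Tendsto (fun e : ℕ => p ^ e) atTop atTop :=
    tendsto_pow_atTop_atTop_of_one_lt hp.one_lt
  have hpR : (0 : ℝ) < p := by exact_mod_cast hp.pos
  constructor
  · rintro ⟨e₀, hI⟩
    obtain ⟨δ, hδ, hpow⟩ := ok.exists_pow_le_ideal
    refine ok.lim_pos hs hL (fun e => ok.length_ne_top (htI e))
      (δ := δ / p ^ e₀) (by positivity) ?_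
    filter_upwards [eventually_ge_atTop e₀] with j hj
    obtain ⟨e, rfl⟩ := Nat.exists_eq_add_of_le' hj
    refine (hI e).trans ((frobeniusPow_le_pow _ _).trans ((hpow _).trans (le_of_eq ?_)))
    congr 1
    push_cast
    rw [pow_add]
    field_simp
  · intro hpos
    by_contra hBAL
    obtain ⟨τ, hτ, hideal⟩ := ok.exists_ideal_le_pow
    obtain ⟨μ, hμ⟩ := exists_pow_mul_le_frobeniusPow (maximalIdeal R)
    refine absurd (ok.lim_nonpos hL ht htI (C := τ * μ) fun i _ => ?_) (not_le.2 hpos)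
    by_contra hcon
    -- Test BAL with `q₀ = p ^ i`. A counterexample weighs less than `τ * μ * p ^ e`, and `i ≤ p ^
    -- i` bounds this by `C * p ^ (e + i) / i`.
    refine hBAL ⟨i, fun e f hf => ?_⟩
    rcases eq_or_ne f 0 with rfl | hf0
    · exact zero_mem _
    refine hμ _ (hideal _ ((ok.dominates.mem_ideal hf0).2 ?_))
    by_contra hlt
    have hlt' : ∀ k, k ≤ p ^ k := fun k => (Nat.lt_pow_self hp.one_lt).le
    refine hcon ⟨e + i, Nat.le_add_left i e, (Nat.le_add_left i e).trans (hlt' _), f, hf, hf0,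
      (not_le.1 hlt).le.trans ?_⟩
    rcases Nat.eq_zero_or_pos i with rfl | hi
    · omega
    have hi' : (0 : ℝ) < i := by exact_mod_cast hi
    have h1 : (i : ℝ) ≤ (p : ℝ) ^ i := by exact_mod_cast hlt' i
    rw [le_div_iff₀ hi']
    push_cast
    rw [pow_add]
    calc τ * (μ * (p : ℝ) ^ e) * i ≤ τ * (μ * (p : ℝ) ^ e) * p ^ i := by gcongr
      _ = _ := by ring

end OKVal

end

/-! ### Assembly of the theorem. -/

theorem theoremB {R : Type*} [CommRing R] [IsDomain R] [IsLocalRing R] [IsNoetherianRing R]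
    (hOK : OKVal.IsOKDomain R) (d : ℕ) (hd : ringKrullDim R = d) :
    (∀ I : ℕ → Ideal R, IdealFamily.IsBBL I → IdealFamily.IsWeaklyGraded I →
      ∃ L : ℝ, Tendsto (fun n : ℕ => IdealFamily.colength (I n) / (n : ℝ) ^ d) atTop (𝓝 L) ∧
        (IdealFamily.IsBAL I ↔ 0 < L)) ∧
    (∀ (p : ℕ) [Fact p.Prime] [CharP R p] (I : ℕ → Ideal R), IdealFamily.IsBBLPow p I →
      (IdealFamily.IsWeaklyPFamily p I ∨
        ((frobenius R p).Finite ∧ PerfectField (IsLocalRing.ResidueField R) ∧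
          IdealFamily.IsWeaklyInversePFamily p I)) →
      ∃ L : ℝ, Tendsto (fun e : ℕ => IdealFamily.colength (I e) / ((p ^ e : ℕ) : ℝ) ^ d)
          atTop (𝓝 L) ∧
        (IdealFamily.IsBALPow p I ↔ 0 < L)) := by
  obtain ⟨d', a, ν, ok⟩ := hOK
  obtain rfl : d = d' := by
    have h := hd.symm.trans ok.dim_eq
    exact_mod_cast h
  obtain _ | d := d
  -- In dimension zero the weight vector vanishes, leaving no room for `0 < c < ‖a‖`.
  · obtain ⟨c, hc, hca, -⟩ := ok.pointed
    rw [Subsingleton.elim a.vec 0, norm_zero] at hca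
    linarith
  obtain ⟨τ, hτ, hideal⟩ := ok.exists_ideal_le_pow
  refine ⟨fun I hB hI => ?_, fun p _ _ I hB hI => ?_⟩
  · obtain ⟨c, hc⟩ := hB
    -- BBL combined with the fifth OK condition: elements of weight linear in `n` lie in `𝔪 ^ (c *
    -- n)`, hence in `I n`.
    have htI : ∀ n : ℕ, ok.dominates.ideal (τ * c * n) ≤ I n := fun n => by
      refine le_trans (le_of_eq ?_) ((hideal (c * n)).trans (hc n))
      rw [Nat.cast_mul, mul_assoc]
    obtain ⟨L, hL⟩ := ok.exists_tendsto_colength_graded ⟨c, hc⟩ hI (by positivity) htI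
    exact ⟨L, hL, ok.isBAL_iff (by positivity) htI hL⟩
  · have hp := (Fact.out : p.Prime)
    obtain ⟨c, hc⟩ := hB
    have htI : ∀ e : ℕ, ok.dominates.ideal (τ * c * (p ^ e : ℕ)) ≤ I e := fun e => by
      refine le_trans (le_of_eq ?_) ((hideal (c * p ^ e)).trans (hc e))
      rw [Nat.cast_mul, mul_assoc]
    obtain ⟨L, hL⟩ : ∃ L : ℝ, Tendsto
        (fun e : ℕ => IdealFamily.colength (I e) / ((p ^ e : ℕ) : ℝ) ^ (d + 1)) atTop (𝓝 L) := by
      rcases hI with hI | ⟨hfin, hperf, hI⟩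
      · exact ok.exists_tendsto_colength_pFamily hp hI (by positivity) htI
      · exact ok.exists_tendsto_colength_inversePFamily hfin ⟨c, hc⟩ hI (by positivity) htI
    exact ⟨L, hL, ok.isBALPow_iff hp (by positivity) htI hL⟩
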